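/- Let $D=\{z\in\mathbb R^2 : |z|<1\}$ be the unit disk, with boundary the unit circle $S^1$. For distinct $P,Q\in D$ let $v_1,v_2\in S^1$ be the two points in which the line $PQ$ meets $S^1$, and define the Beltrami–Klein distance $$d'(P,Q)=\frac12\left|\log\frac{|v_1Q|\,|v_2P|}{|v_1P|\,|v_2Q|}\right|,\qquad d'(P,P)=0.$$ For an integer $n\ge 1$ and distinct $P,Q\in D$ put $$\Delta_n'(P,Q)=\log\frac{e^{n\,d'(P,Q)}+1}{e^{n\,d'(P,Q)}-1},$$ and for $R\in D$ let $\delta(P,Q,R)$ be the minimum of $d'(R,S)$ over the points $S\in D$ of the line $PQ$. For a nonempty compact convex set $U\subset D$ and $v\in S^1$, let $\psi_U(v)\in S^1$ be the first point $w\neq v$, counterclockwise from $v$, such that the line $vw$ is tangent to (i.e. a supporting line of) $U$. Precisely, let $\mathcal R(v)$ be $v$ rotated counterclockwise by a right angle, and let $\theta(v)$ be the minimum over $u\in U$ of the gradient of the line $uv$ in the coordinates given by the basis $\{v,\mathcal R(v)\}$; then $\psi_U(v)$ is the second intersection of $S^1$ with the line through $v$ whose gradient in this basis is $\theta(v)$.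 Identify $S^1$ with $\mathbb R/\mathbb Z$. For an orientation-preserving homeomorphism $f$ of $S^1$ let $\overline f:\mathbb R\to\mathbb R$ be its lift with $\overline f(0)\in[0,1)$; the rotation number of $f$ is $\rho(f)=\lim_{n\to\infty}\bigl(\overline f^{\,n}(x)-x\bigr)/n$, which exists and does not depend on $x\in\mathbb R$. **Theorem.** Let $P,Q,R\in D$ be the vertices of a (non-degenerate) triangle $\triangle PQR$, regarded as a closed convex set. Suppose that $$\Delta_2'(P,Q)\le\delta(P,Q,R)\le\tfrac12\Delta_1'(P,Q)\quad\text{or}\quad \tfrac12\Delta_1'(P,Q)\le\delta(P,Q,R)\le\Delta_2'(P,Q).$$ Then $\psi_{\triangle PQR}$ is an orientation-preserving homeomorphism of $S^1$ and $\rho(\psi_{\triangle PQR})=\frac25$. -/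

import Mathlib

/-!
The plane `ℝ²` is identified with `ℂ` (with its Euclidean norm and real inner product),
the open unit disk `D` is `{z | ‖z‖ < 1}`, the unit circle `S¹` is `Circle`, and
`x ↦ Circle.exp (2 * π * x)` is the covering map `ℝ → ℝ/ℤ = S¹`.
-/

noncomputable section

namespace BarBilliard

/-! ### The Beltrami–Klein model -/

/-- The parameter of the point at infinity in which the ray from `P` through `Q` leaves the disk:
the nonnegative root `s` of `‖P + s (Q - P)‖ = 1`. -/
def exitParam (P Q : ℂ) : ℝ :=
  (-inner ℝ P (Q - P) + Real.sqrt (inner ℝ P (Q - P) ^ 2 + ‖Q - P‖ ^ 2 * (1 - ‖P‖ ^ 2)))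
    / ‖Q - P‖ ^ 2

/-- For distinct `P, Q` in the disk, the point of the unit circle in which the ray from `P`
through `Q` leaves the disk. The line `PQ` meets the circle in `exitPoint Q P` and
`exitPoint P Q`. -/
def exitPoint (P Q : ℂ) : ℂ := P + (exitParam P Q : ℂ) * (Q - P)

theorem norm_exitPoint {P Q : ℂ} (hP : ‖P‖ < 1) (hPQ : P ≠ Q) : ‖exitPoint P Q‖ = 1 := by
  have hn : ‖Q - P‖ ≠ 0 := norm_ne_zero_iff.2 (sub_ne_zero.2 hPQ.symm)
  have hP2 : 0 ≤ 1 - ‖P‖ ^ 2 := by nlinarith [norm_nonneg P]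
  have hdisc : 0 ≤ inner ℝ P (Q - P) ^ 2 + ‖Q - P‖ ^ 2 * (1 - ‖P‖ ^ 2) := by positivity
  have hsq := Real.sq_sqrt hdisc
  have key : ‖exitPoint P Q‖ ^ 2 = 1 := by
    have e : exitPoint P Q = P + exitParam P Q • (Q - P) := by simp [exitPoint]
    rw [e, norm_add_sq_real, inner_smul_right, norm_smul, mul_pow, Real.norm_eq_abs, sq_abs]
    simp only [exitParam]
    field_simp
    linear_combination hsq
  have h0 := norm_nonneg (exitPoint P Q)
  nlinarith

/-- The point at infinity lies beyond `Q` on the ray from `P` through `Q`. -/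
theorem one_lt_exitParam {P Q : ℂ} (hQ : ‖Q‖ < 1) (hPQ : P ≠ Q) :
    1 < exitParam P Q := by
  have hn : 0 < ‖Q - P‖ ^ 2 := by
    have : 0 < ‖Q - P‖ := norm_pos_iff.2 (sub_ne_zero.2 hPQ.symm)
    positivity
  have hQ2 : ‖Q‖ ^ 2 < 1 := by nlinarith [norm_nonneg Q]
  have e : ‖Q‖ ^ 2 = ‖P‖ ^ 2 + 2 * inner ℝ P (Q - P) + ‖Q - P‖ ^ 2 := by
    rw [← norm_add_sq_real]
    simp
  rw [exitParam, lt_div_iff₀ hn]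
  have : ‖Q - P‖ ^ 2 + inner ℝ P (Q - P) <
      Real.sqrt (inner ℝ P (Q - P) ^ 2 + ‖Q - P‖ ^ 2 * (1 - ‖P‖ ^ 2)) := by
    apply Real.lt_sqrt_of_sq_lt
    nlinarith
  linarith

/-- The Beltrami–Klein distance `d'(P, Q) = ½ |log (|v₁Q| |v₂P| / (|v₁P| |v₂Q|))|`, where
`v₁, v₂` are the points at infinity of the line `PQ`; it is `0` for `P = Q`. -/
def kleinDist (P Q : ℂ) : ℝ :=
  if P = Q then 0
  else 1 / 2 * |Real.log
    ((dist (exitPoint Q P) Q * dist (exitPoint P Q) P) /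
      (dist (exitPoint Q P) P * dist (exitPoint P Q) Q))|

/-- `Δₙ'(P, Q) = log ((e^{n d'(P,Q)} + 1) / (e^{n d'(P,Q)} - 1))`. -/
def Delta (n : ℕ) (P Q : ℂ) : ℝ :=
  Real.log ((Real.exp (n * kleinDist P Q) + 1) / (Real.exp (n * kleinDist P Q) - 1))

/-- `δ(P, Q, R)`: the least distance from `R` to a point `S` of the hyperbolic line `PQ`. -/
def lineDist (P Q R : ℂ) : ℝ :=
  sInf {d : ℝ | ∃ S : ℂ, S ∈ line[ℝ, P, Q] ∧ ‖S‖ < 1 ∧ d = kleinDist R S}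

/-! ### The bar-billiard map -/

/-- The gradient of the line through `u` and `v` in the coordinates given by the basis
`{v, R v}`, where `R v = i v` is `v` rotated counterclockwise by a right angle. -/
def lineGradient (u v : ℂ) : ℝ :=
  inner ℝ (Complex.I * v) (u - v) / inner ℝ v (u - v)

/-- The least gradient of a line joining `v` to a point of `U`. For `v ∈ S¹` and `U` compact in the
open disk, this is the gradient of the first supporting line of `U` through `v`, i.e. the
one whose other end on the circle comes first counterclockwise from `v`. -/
def minGradient (U : Set ℂ) (v : ℂ) : ℝ := sInf ((fun u => lineGradient u v) '' U)

/-- The bar-billiard map `ψ_U` of `S¹`: the point `ψ_U v` is the second intersection of the unit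
circle with the line through `v` of gradient `minGradient U v` in the basis `{v, R v}`. -/
def psi (U : Set ℂ) (v : Circle) : Circle :=
  ⟨(⟨0, 1⟩ : EuclideanGeometry.Sphere ℂ).secondInter (v : ℂ)
      ((v : ℂ) + (minGradient U v : ℂ) * (Complex.I * v)), by
    refine mem_sphere_zero_iff_norm.2 ?_
    rw [← dist_zero_right]
    exact (EuclideanGeometry.Sphere.secondInter_dist ⟨0, 1⟩ _ _).trans (by simpa using Circle.norm_coe v)⟩

/-! ### Rotation numbers -/

/-- `F` is the lift of `f` to `ℝ`, normalised by `F 0 ∈ [0, 1)`, and witnesses that `f` is an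
orientation-preserving homeomorphism of the circle. -/
structure IsNormalizedLift (f : Circle → Circle) (F : ℝ → ℝ) : Prop where
  continuous : Continuous F
  strictMono : StrictMono F
  map_add_one : ∀ x, F (x + 1) = F x + 1
  semiconj : ∀ x, Circle.exp (2 * Real.pi * F x) = f (Circle.exp (2 * Real.pi * x))
  map_zero_mem : F 0 ∈ Set.Ico (0 : ℝ) 1

/-- `f` is an orientation-preserving homeomorphism of the circle whose rotation number
`lim (Fⁿ x - x) / n` (for every `x`, with `F` the normalised lift) exists and equals `ρ`. -/
def HasRotationNumber (f : Circle → Circle) (ρ : ℝ) : Prop :=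
  ∃ F : ℝ → ℝ, IsNormalizedLift f F ∧
    ∀ x : ℝ, Filter.Tendsto (fun n : ℕ => (F^[n] x - x) / n) Filter.atTop (nhds ρ)

end BarBilliard

end

/-! From a boundary point `v`, each vertex `X` defines the involution of the circle by chords
through `X`, and the supporting line reached first passes through a vertex. So the billiard map
lifts to `F`, the pointwise minimum of the three lifted involutions (`triangleLift`). By the
intermediate value theorem, rotation number 2/5 follows once `F⁵ x ≤ x + 2` holds for some `x` and
`F⁵ x ≥ x + 2` for some other (`tendsto_rotation_of_crossing`).

On square roots of boundary points the involution by chords through `X` becomes a real linear map,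
`spinMap X`, so orders of points on the line are signs of 2×2 determinants. In the basis given by
the ends of the chord `PQ`, the matrices of `P` and `Q` are antidiagonal.

Two orbits suffice. The orbit that runs along the chord `PQ` in its third step compares `F⁵ w` with
`w + 2` exactly, according to the order of `δ` and `Δ₁'/2` (`ChordFrame.fifth_iterate`). If `Δ₂' ≤
δ`, then bounding `F` by the vertices `P, Q, P, Q, R` in turn gives a point with `F⁵ v ≤ v + 2`
(`ChordFrame.exists_iterate_le`). If `δ ≤ Δ₂'`, the first comparison applied to the side `QR` gives
the lower bound, because `P` is no farther from the line `QR` than from `Q`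
(`exists_le_fifth_iterate`).

Hyperbolic distances enter through the Lorentzian products `gram` and the area, which turn all four
hypotheses into polynomial inequalities. -/

noncomputable section

namespace BarBilliard

open Complex ComplexConjugate

/-! ### Determinants, Lorentzian products and square roots of boundary points -/

/-- The determinant `u × v` of two plane vectors. -/
def cross (u v : ℂ) : ℝ := u.re * v.im - u.im * v.re

/-- The Lorentzian product `1 - ⟨X, Y⟩` of the lifts of `X`, `Y` to the hyperboloid cone. -/
def gram (X Y : ℂ) : ℝ := 1 - (X.re * Y.re + X.im * Y.im)

theorem gram_comm (X Y : ℂ) : gram X Y = gram Y X := by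
  simp only [gram]; ring

theorem norm_sq_eq_re_im (X : ℂ) : ‖X‖ ^ 2 = X.re ^ 2 + X.im ^ 2 := by
  rw [← Complex.normSq_eq_norm_sq, Complex.normSq_apply]; ring

theorem gram_self (X : ℂ) : gram X X = 1 - ‖X‖ ^ 2 := by
  rw [norm_sq_eq_re_im, gram]; ring

theorem gram_self_pos {X : ℂ} (hX : ‖X‖ < 1) : 0 < gram X X := by
  rw [gram_self]; nlinarith [norm_nonneg X]

theorem gram_pos {X Y : ℂ} (hX : ‖X‖ < 1) (hY : ‖Y‖ ≤ 1) : 0 < gram X Y := by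
  have h := Complex.abs_re_le_norm (conj X * Y)
  have e : (conj X * Y).re = X.re * Y.re + X.im * Y.im := by simp
  rw [e, norm_mul, Complex.norm_conj] at h
  have h2 : ‖X‖ * ‖Y‖ < 1 := by nlinarith [norm_nonneg X, norm_nonneg Y]
  have := le_abs_self (X.re * Y.re + X.im * Y.im)
  simp only [gram]; linarith

/-- The unit vector `e^{iπt}`, a square root of the point of the circle with parameter `t`. -/
def spin (t : ℝ) : ℂ := ⟨Real.cos (Real.pi * t), Real.sin (Real.pi * t)⟩

theorem spin_eq_exp (t : ℝ) : spin t = Complex.exp ((Real.pi * t : ℝ) * I) := by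
  apply Complex.ext <;> simp only [Complex.exp_ofReal_mul_I_re, Complex.exp_ofReal_mul_I_im, spin]

theorem spin_re_sq_add_im_sq (t : ℝ) : (spin t).re ^ 2 + (spin t).im ^ 2 = 1 := by
  simp [spin]

theorem coe_circle_exp (t : ℝ) : (Circle.exp (2 * Real.pi * t) : ℂ) = spin t ^ 2 := by
  rw [Circle.coe_exp, spin_eq_exp, ← Complex.exp_nat_mul]
  push_cast; ring_nf

theorem norm_spin_sq (t : ℝ) : ‖spin t ^ 2‖ = 1 := by
  rw [← coe_circle_exp]; exact Circle.norm_coe _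

theorem spin_add_one (t : ℝ) : spin (t + 1) = -spin t := by
  apply Complex.ext <;> simp [spin, mul_add, Real.cos_add_pi, Real.sin_add_pi]

theorem spin_sub_one (t : ℝ) : spin (t - 1) = -spin t := by
  apply Complex.ext <;> simp [spin, mul_sub, Real.cos_sub_pi, Real.sin_sub_pi]

theorem cross_spin (s t : ℝ) : cross (spin s) (spin t) = Real.sin (Real.pi * (t - s)) := by
  rw [mul_sub, Real.sin_sub]; simp only [cross, spin]; ring

theorem cross_spin_pos {s t : ℝ} (h : s < t) (h' : t < s + 1) : 0 < cross (spin s) (spin t) := by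
  rw [cross_spin]
  apply Real.sin_pos_of_pos_of_lt_pi <;> nlinarith [Real.pi_pos]

theorem cross_anticomm (u v : ℂ) : cross u v = -cross v u := by
  simp only [cross]; ring

/-- If `t < s`, then `s` lies less than one unit past `t`, where the sine has a strict sign. A
determinant orders parameters only within such a window, so every later comparison must supply this
bound. -/
theorem le_of_cross_spin_nonneg {s t : ℝ} (h : s < t + 1) (hc : 0 ≤ cross (spin s) (spin t)) :
    s ≤ t := by
  by_contra! hlt
  have := cross_spin_pos hlt h
  rw [cross_anticomm] at this; linarith

theorem lt_of_cross_spin_pos {s t : ℝ} (h : s < t + 1) (hc : 0 < cross (spin s) (spin t)) :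
    s < t := by
  refine lt_of_le_of_ne (le_of_cross_spin_nonneg h hc.le) ?_
  rintro rfl
  simp [cross, mul_comm] at hc

theorem eq_of_cross_spin_eq_zero {s t : ℝ} (h : s < t + 1) (h' : t < s + 1)
    (hc : cross (spin s) (spin t) = 0) : s = t :=
  le_antisymm (le_of_cross_spin_nonneg h hc.ge)
    (le_of_cross_spin_nonneg h' (by rw [cross_anticomm, hc, neg_zero]))

/-- Every nonzero vector is a positive multiple of some `spin t`, with `t` in a given interval
of length two. -/
theorem exists_spin_eq (z : ℂ) (a : ℝ) :
    ∃ t ∈ Set.Ico a (a + 2), (‖z‖ : ℂ) * spin t = z := by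
  have h2 : (0 : ℝ) < 2 := two_pos
  refine ⟨toIcoMod h2 a (z.arg / Real.pi), toIcoMod_mem_Ico h2 a _, ?_⟩
  have e : Real.pi * toIcoMod h2 a (z.arg / Real.pi) =
      z.arg - toIcoDiv h2 a (z.arg / Real.pi) * (2 * Real.pi) := by
    have := Real.pi_ne_zero
    rw [toIcoMod, zsmul_eq_mul]
    field_simp
  apply Complex.ext
  · rw [re_ofReal_mul, spin, e, Real.cos_sub_int_mul_two_pi, Complex.norm_mul_cos_arg]
  · rw [im_ofReal_mul, spin, e, Real.sin_sub_int_mul_two_pi, Complex.norm_mul_sin_arg]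

/-! ### Chord involutions and their lifts to the line -/

/-- The real linear map lifting the involution of the circle by chords through `X`. -/
def spinMap (X z : ℂ) : ℂ := I * (z - X * conj z)

theorem spinMap_re (X z : ℂ) : (spinMap X z).re = -(z.im - (X.im * z.re - X.re * z.im)) := by
  simp [spinMap]; ring

theorem spinMap_im (X z : ℂ) : (spinMap X z).im = z.re - (X.re * z.re + X.im * z.im) := by
  simp [spinMap]

theorem spinMap_real_mul (X z : ℂ) (r : ℝ) : spinMap X (r * z) = r * spinMap X z := by
  simp [spinMap]; ring

/-- Cayley–Hamilton: the map has trace zero and determinant `gram X X`. The minus sign is a shift of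
the spin parameter by one. -/
theorem spinMap_spinMap (X z : ℂ) : spinMap X (spinMap X z) = (gram X X : ℂ) * -z := by
  apply Complex.ext <;> simp [spinMap_re, spinMap_im, gram] <;> ring

theorem inner_sub_eq (u v : ℂ) : inner ℝ v (u - v) = v.re * (u.re - v.re) + v.im * (u.im - v.im) := by
  simp [Complex.inner]; ring

theorem inner_I_mul_sub_eq (u v : ℂ) :
    inner ℝ (I * v) (u - v) = v.re * (u.im - v.im) - v.im * (u.re - v.re) := by
  simp [Complex.inner]; ring

theorem inner_sub_neg {u v : ℂ} (hu : ‖u‖ < 1) (hv : ‖v‖ = 1) : inner ℝ v (u - v) < 0 := by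
  have h := gram_pos hu hv.le
  have hv2 := norm_sq_eq_re_im v
  rw [hv] at hv2
  rw [inner_sub_eq]
  simp only [gram] at h
  nlinarith

/-- The lift to `ℝ` of the involution of the circle by chords through `X`. -/
def chordLift (X : ℂ) (t : ℝ) : ℝ :=
  t + 1 / 2 + Real.arctan (lineGradient X (Circle.exp (2 * Real.pi * t))) / Real.pi

theorem arctan_div_pi_mem (m : ℝ) : Real.arctan m / Real.pi ∈ Set.Ioo (-(1 / 2) : ℝ) (1 / 2) := by
  have hpi := Real.pi_pos
  constructor
  · rw [lt_div_iff₀ hpi]; have := Real.neg_pi_div_two_lt_arctan m; linarith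
  · rw [div_lt_iff₀ hpi]; have := Real.arctan_lt_pi_div_two m; linarith

theorem lt_chordLift (X : ℂ) (t : ℝ) : t < chordLift X t := by
  have := (arctan_div_pi_mem (lineGradient X (Circle.exp (2 * Real.pi * t)))).1
  simp only [chordLift]; linarith

theorem chordLift_lt (X : ℂ) (t : ℝ) : chordLift X t < t + 1 := by
  have := (arctan_div_pi_mem (lineGradient X (Circle.exp (2 * Real.pi * t)))).2
  simp only [chordLift]; linarith

theorem circle_exp_add_one (t : ℝ) :
    Circle.exp (2 * Real.pi * (t + 1)) = Circle.exp (2 * Real.pi * t) := by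
  rw [mul_add, mul_one, Circle.exp_add, Circle.exp_two_pi, mul_one]

theorem chordLift_add_one (X : ℂ) (t : ℝ) : chordLift X (t + 1) = chordLift X t + 1 := by
  simp only [chordLift, circle_exp_add_one]; ring

theorem chordLift_sub_one (X : ℂ) (t : ℝ) : chordLift X (t - 1) = chordLift X t - 1 := by
  have := chordLift_add_one X (t - 1)
  rw [sub_add_cancel] at this; linarith

/-- `arctan m` is the argument of `1 + m i`, and `√(1 + m²)` its modulus; the shift by 1/2 is the
factor `i`. -/
theorem spin_half_add_arctan (t m : ℝ) :
    (Real.sqrt (1 + m ^ 2) : ℂ) * spin (t + 1 / 2 + Real.arctan m / Real.pi) =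
      I * spin t * (1 + m * I) := by
  have hpi := Real.pi_ne_zero
  have hs : Real.sqrt (1 + m ^ 2) ≠ 0 := by positivity
  have e : Real.pi * (t + 1 / 2 + Real.arctan m / Real.pi) =
      (Real.pi * t + Real.arctan m) + Real.pi / 2 := by field_simp; ring
  apply Complex.ext <;>
  · simp only [spin, e, Real.cos_add_pi_div_two, Real.sin_add_pi_div_two, Real.cos_add (Real.pi * t),
      Real.sin_add (Real.pi * t), Real.cos_arctan, Real.sin_arctan]
    simp
    field_simp
    ring

/-- The bridge between the nonlinear lift and the linear map. The factor is positive because `X` is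
strictly inside the disk, so the agreement fixes the sign as well as the point of the circle. -/
theorem exists_pos_mul_spin_chordLift {X : ℂ} (hX : ‖X‖ < 1) (t : ℝ) :
    ∃ r : ℝ, 0 < r ∧ (r : ℂ) * spin (chordLift X t) = spinMap X (spin t) := by
  set v : ℂ := (Circle.exp (2 * Real.pi * t) : ℂ) with hv
  have hn : ‖v‖ = 1 := Circle.norm_coe _
  have hd := inner_sub_neg hX hn
  have hv2 : v = spin t ^ 2 := coe_circle_exp t
  set m := lineGradient X v with hm
  refine ⟨-inner ℝ v (X - v) * Real.sqrt (1 + m ^ 2), by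
    have : 0 < Real.sqrt (1 + m ^ 2) := by positivity
    exact mul_pos (by linarith) this, ?_⟩
  have h := spin_half_add_arctan t m
  rw [ofReal_mul, mul_assoc, chordLift, ← hv, ← hm, h]
  have hmm : m * inner ℝ v (X - v) = inner ℝ (I * v) (X - v) := by
    rw [hm, lineGradient, div_mul_cancel₀ _ hd.ne]
  have e1 : ((-inner ℝ v (X - v) : ℝ) : ℂ) * (I * spin t * (1 + m * I)) =
      I * spin t * (-inner ℝ v (X - v) - (m * inner ℝ v (X - v) : ℝ) * I) := by
    push_cast; ring
  rw [e1, hmm, inner_sub_eq, inner_I_mul_sub_eq, hv2]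
  have h1 := spin_re_sq_add_im_sq t
  generalize spin t = z at *
  -- Even powers of `z.im` are eliminated by `|z| = 1`, which leaves a polynomial identity.
  have h2 : z.im ^ 2 = 1 - z.re ^ 2 := by linarith
  have h3 : z.im ^ 3 = (1 - z.re ^ 2) * z.im := by rw [← h2]; ring
  have h4 : z.im ^ 4 = (1 - z.re ^ 2) ^ 2 := by rw [← h2]; ring
  have h5 : z.im ^ 5 = (1 - z.re ^ 2) ^ 2 * z.im := by rw [← h2]; ring
  apply Complex.ext <;> simp [spinMap, pow_two] <;> ring_nf <;> simp only [h2, h3, h4, h5] <;> ring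

/-- The square of the linear map is a negative scalar, so the result is congruent to `t + 1` modulo
2; it also lies strictly between `t` and `t + 2`. -/
theorem chordLift_chordLift {X : ℂ} (hX : ‖X‖ < 1) (t : ℝ) :
    chordLift X (chordLift X t) = t + 1 := by
  obtain ⟨r, hr, e⟩ := exists_pos_mul_spin_chordLift hX t
  obtain ⟨r', hr', e'⟩ := exists_pos_mul_spin_chordLift hX (chordLift X t)
  have h := spinMap_spinMap X (spin t)
  rw [← e, spinMap_real_mul, ← e', ← spin_add_one, ← mul_assoc, ← ofReal_mul] at h
  have h1 := lt_chordLift X t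
  have h2 := chordLift_lt X t
  have h3 := lt_chordLift X (chordLift X t)
  have h4 := chordLift_lt X (chordLift X t)
  apply eq_of_cross_spin_eq_zero (by linarith) (by linarith)
  have hre := congrArg Complex.re h
  have him := congrArg Complex.im h
  rw [re_ofReal_mul, re_ofReal_mul] at hre
  rw [im_ofReal_mul, im_ofReal_mul] at him
  have hrr : r * r' ≠ 0 := by positivity
  apply mul_left_cancel₀ hrr
  simp only [cross]
  linear_combination (spin (t + 1)).im * hre - (spin (t + 1)).re * him

theorem continuous_chordLift {X : ℂ} (hX : ‖X‖ < 1) : Continuous (chordLift X) := by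
  have hc : Continuous fun t : ℝ => (Circle.exp (2 * Real.pi * t) : ℂ) := by fun_prop
  have : Continuous fun t : ℝ => lineGradient X (Circle.exp (2 * Real.pi * t)) := by
    unfold lineGradient
    refine Continuous.div ?_ ?_ fun t => (inner_sub_neg hX (Circle.norm_coe _)).ne
    · exact (continuous_const.mul hc).inner (continuous_const.sub hc)
    · exact hc.inner (continuous_const.sub hc)
  unfold chordLift
  exact (continuous_id.add continuous_const).add ((Real.continuous_arctan.comp this).div_const _)

theorem strictMono_chordLift {X : ℂ} (hX : ‖X‖ < 1) : StrictMono (chordLift X) := by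
  have hinj : Function.Injective (chordLift X) := fun s t h => by
    have h1 := chordLift_chordLift hX s
    rw [h, chordLift_chordLift hX t] at h1; linarith
  refine ((continuous_chordLift hX).strictMono_of_inj hinj).resolve_right fun h => ?_
  have := h (show (0 : ℝ) < 0 + 1 by norm_num)
  rw [chordLift_add_one] at this; linarith

/-! ### The lift of the bar-billiard map -/

/-- The denominator of the gradient is negative on the disk, so a lower bound on the gradient cuts
out a half-plane; one that contains the vertices contains their hull. -/
theorem isLeast_lineGradient {P Q R : ℂ} (hP : ‖P‖ < 1) (hQ : ‖Q‖ < 1) (hR : ‖R‖ < 1) {v : ℂ}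
    (hv : ‖v‖ = 1) :
    IsLeast ((fun u => lineGradient u v) '' convexHull ℝ ({P, Q, R} : Set ℂ))
      (min (lineGradient P v) (min (lineGradient Q v) (lineGradient R v))) := by
  set m := min (lineGradient P v) (min (lineGradient Q v) (lineGradient R v)) with hm
  have hsub := subset_convexHull ℝ ({P, Q, R} : Set ℂ)
  constructor
  · rcases min_choice (lineGradient P v) (min (lineGradient Q v) (lineGradient R v)) with h | h
    · exact ⟨P, hsub (by simp), by rw [hm, h]⟩
    · rcases min_choice (lineGradient Q v) (lineGradient R v) with h' | h'
      · exact ⟨Q, hsub (by simp), by rw [hm, h, h']⟩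
      · exact ⟨R, hsub (by simp), by rw [hm, h, h']⟩
  · rintro _ ⟨u, hu, rfl⟩
    have hball : convexHull ℝ ({P, Q, R} : Set ℂ) ⊆ Metric.ball 0 1 :=
      convexHull_min (by rintro x (rfl | rfl | rfl) <;> simpa) (convex_ball _ _)
    have hu1 : ‖u‖ < 1 := by simpa using hball hu
    have hlin : IsLinearMap ℝ fun u : ℂ => inner ℝ (I * v) u - m * inner ℝ v u := by
      constructor
      · intro x y; simp only [inner_add_right]; ring
      · intro c x; simp only [inner_smul_right, smul_eq_mul]; ring
    have hconv : convexHull ℝ ({P, Q, R} : Set ℂ) ⊆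
        {u | inner ℝ (I * v) u - m * inner ℝ v u ≤ inner ℝ (I * v) v - m * inner ℝ v v} := by
      refine convexHull_min ?_ (convex_halfSpace_le hlin _)
      have key : ∀ X : ℂ, ‖X‖ < 1 → m ≤ lineGradient X v →
          inner ℝ (I * v) X - m * inner ℝ v X ≤ inner ℝ (I * v) v - m * inner ℝ v v := by
        intro X hX h
        have hd := inner_sub_neg hX hv
        rw [lineGradient, le_div_iff_of_neg hd, inner_sub_right, inner_sub_right] at h
        linarith
      rintro x (rfl | rfl | rfl)
      · exact key _ hP (min_le_left _ _)
      · exact key _ hQ ((min_le_right _ _).trans (min_le_left _ _))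
      · exact key _ hR ((min_le_right _ _).trans (min_le_right _ _))
    have hu2 := hconv hu
    have hd := inner_sub_neg hu1 hv
    simp only [Set.mem_ofPred_eq] at hu2
    simp only [lineGradient]
    rw [le_div_iff_of_neg hd, inner_sub_right, inner_sub_right]
    linarith

/-- The lift of the bar-billiard map of the triangle `PQR`. -/
def triangleLift (P Q R : ℂ) (t : ℝ) : ℝ :=
  min (chordLift P t) (min (chordLift Q t) (chordLift R t))

theorem triangleLift_rotate (P Q R : ℂ) : triangleLift Q R P = triangleLift P Q R := by
  funext t
  simp only [triangleLift]
  rw [← min_assoc, min_comm]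

theorem triangleLift_eq {P Q R : ℂ} (hP : ‖P‖ < 1) (hQ : ‖Q‖ < 1) (hR : ‖R‖ < 1) (t : ℝ) :
    triangleLift P Q R t = t + 1 / 2 + Real.arctan
      (minGradient (convexHull ℝ ({P, Q, R} : Set ℂ)) (Circle.exp (2 * Real.pi * t))) /
        Real.pi := by
  rw [minGradient, (isLeast_lineGradient hP hQ hR (Circle.norm_coe _)).csInf_eq]
  have hmono : Monotone fun m : ℝ => t + 1 / 2 + Real.arctan m / Real.pi := fun x y h => by
    have := Real.arctan_mono h
    have := Real.pi_pos
    simp only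
    gcongr
  rw [hmono.map_min, hmono.map_min]
  rfl

theorem strictMono_triangleLift {P Q R : ℂ} (hP : ‖P‖ < 1) (hQ : ‖Q‖ < 1) (hR : ‖R‖ < 1) :
    StrictMono (triangleLift P Q R) := fun _ _ h =>
  min_lt_min (strictMono_chordLift hP h)
    (min_lt_min (strictMono_chordLift hQ h) (strictMono_chordLift hR h))

theorem triangleLift_add_one (P Q R : ℂ) (t : ℝ) :
    triangleLift P Q R (t + 1) = triangleLift P Q R t + 1 := by
  simp only [triangleLift, chordLift_add_one, min_add_add_right]

/-- The chord direction is `v (1 + m i)`, and reflection in its perpendicular sends `v` to `-v`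
times the square of the unit vector along `1 + m i`. -/
theorem coe_psi (U : Set ℂ) (v : Circle) :
    (psi U v : ℂ) = -v * (1 + minGradient U v * I) ^ 2 / (1 + minGradient U v ^ 2) := by
  set m := minGradient U v
  have hm : (1 : ℝ) + m ^ 2 ≠ 0 := by positivity
  have hmC : (1 : ℂ) + (m : ℂ) ^ 2 ≠ 0 := by exact_mod_cast hm
  have hv : (v : ℂ).re ^ 2 + (v : ℂ).im ^ 2 = 1 := by
    rw [← norm_sq_eq_re_im, Circle.norm_coe, one_pow]
  have e : (psi U v : ℂ) = ((-2 * inner ℝ ((v : ℂ) + m * (I * v)) ((v : ℂ) -ᵥ 0) /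
      inner ℝ ((v : ℂ) + m * (I * v)) ((v : ℂ) + m * (I * v)) : ℝ) : ℂ) *
        ((v : ℂ) + m * (I * v)) + v := rfl
  have e1 : inner ℝ ((v : ℂ) + m * (I * v)) ((v : ℂ) -ᵥ 0) = (1 : ℝ) := by
    simp [Complex.inner]; linear_combination hv
  have e2 : inner ℝ ((v : ℂ) + m * (I * v)) ((v : ℂ) + m * (I * v)) = 1 + m ^ 2 := by
    rw [real_inner_self_eq_norm_sq, norm_sq_eq_re_im]
    simp; linear_combination (1 + m ^ 2) * hv
  rw [e, e1, e2]
  push_cast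
  field_simp
  linear_combination (m : ℂ) ^ 2 * I_sq

theorem isNormalizedLift_triangleLift {P Q R : ℂ} (hP : ‖P‖ < 1) (hQ : ‖Q‖ < 1) (hR : ‖R‖ < 1) :
    IsNormalizedLift (psi (convexHull ℝ ({P, Q, R} : Set ℂ))) (triangleLift P Q R) where
  continuous := (continuous_chordLift hP).min
    ((continuous_chordLift hQ).min (continuous_chordLift hR))
  strictMono := strictMono_triangleLift hP hQ hR
  map_add_one := triangleLift_add_one P Q R
  semiconj t := by
    apply Circle.ext
    rw [coe_circle_exp, coe_psi, triangleLift_eq hP hQ hR, coe_circle_exp]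
    set m := minGradient (convexHull ℝ ({P, Q, R} : Set ℂ)) (Circle.exp (2 * Real.pi * t))
    have h := congrArg (fun z => z ^ 2) (spin_half_add_arctan t m)
    simp only [mul_pow, I_sq, ← ofReal_pow, Real.sq_sqrt (show 0 ≤ 1 + m ^ 2 by positivity)] at h
    have hmC : (1 : ℂ) + (m : ℂ) ^ 2 ≠ 0 := by
      have hm : (1 : ℝ) + m ^ 2 ≠ 0 := by positivity
      exact_mod_cast hm
    rw [← coe_circle_exp t] at h ⊢
    rw [eq_div_iff hmC, mul_comm]
    simp only [ofReal_add, ofReal_one, ofReal_pow] at h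
    linear_combination h
  map_zero_mem := by
    rw [triangleLift_eq hP hQ hR]
    have := arctan_div_pi_mem (minGradient (convexHull ℝ ({P, Q, R} : Set ℂ))
      (Circle.exp (2 * Real.pi * 0)))
    exact ⟨by linarith [this.1], by linarith [this.2]⟩

/-! ### A criterion for a rational rotation number -/

theorem tendsto_rotation_of_crossing {F : ℝ → ℝ} (hc : Continuous F) (hm : Monotone F)
    (h1 : ∀ x, F (x + 1) = F x + 1) {n k : ℕ} (hn : 0 < n) (hlo : ∃ x, x + k ≤ F^[n] x)
    (hhi : ∃ x, F^[n] x ≤ x + k) (x : ℝ) :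
    Filter.Tendsto (fun j : ℕ => (F^[j] x - x) / j) Filter.atTop (nhds ((k : ℝ) / n)) := by
  let f : CircleDeg1Lift := ⟨⟨F, hm⟩, h1⟩
  have hf : ∀ j : ℕ, ⇑(f ^ j) = F^[j] := fun j => CircleDeg1Lift.coe_pow f j
  obtain ⟨y, hy⟩ := hlo
  obtain ⟨z, hz⟩ := hhi
  have hcont : Continuous fun x => F^[n] x - x := (hc.iterate n).sub continuous_id
  obtain ⟨w, hw⟩ := mem_range_of_exists_le_of_exists_ge hcont
    ⟨z, show F^[n] z - z ≤ k by linarith⟩ ⟨y, show (k : ℝ) ≤ F^[n] y - y by linarith⟩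
  have hw' : (f ^ n) w = w + (k : ℤ) := by
    rw [hf]; push_cast; simp only at hw; linarith
  have ht := f.translationNumber_of_map_pow_eq_add_int hw' hn
  have := f.tendsto_translationNumber x
  rw [ht] at this
  simpa [hf] using this

/-! ### Directions and the order of the line -/

theorem cross_real_mul_left (r : ℝ) (u v : ℂ) : cross (r * u) v = r * cross u v := by
  simp [cross]; ring

theorem cross_real_mul_right (r : ℝ) (u v : ℂ) : cross u (r * v) = r * cross u v := by
  simp [cross]; ring

/-- `z` is a positive multiple of `spin t`. -/
def HasDirection (z : ℂ) (t : ℝ) : Prop := ∃ r : ℝ, 0 < r ∧ (r : ℂ) * spin t = z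

namespace HasDirection

variable {z w : ℂ} {s t : ℝ}

theorem of_spin (t : ℝ) : HasDirection (spin t) t := ⟨1, one_pos, by simp⟩

theorem real_mul (h : HasDirection z t) {c : ℝ} (hc : 0 < c) : HasDirection (c * z) t := by
  obtain ⟨r, hr, e⟩ := h
  exact ⟨c * r, mul_pos hc hr, by rw [← e]; push_cast; ring⟩

theorem of_real_mul {c : ℝ} (h : HasDirection (c * z) t) (hc : 0 < c) : HasDirection z t := by
  have := h.real_mul (inv_pos.2 hc)
  rwa [← mul_assoc, ← ofReal_mul, inv_mul_cancel₀ hc.ne', ofReal_one, one_mul] at this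

theorem neg_sub_one (h : HasDirection z t) : HasDirection (-z) (t - 1) := by
  obtain ⟨r, hr, e⟩ := h
  exact ⟨r, hr, by rw [spin_sub_one, ← e]; ring⟩

theorem map (h : HasDirection z t) {X : ℂ} (hX : ‖X‖ < 1) :
    HasDirection (spinMap X z) (chordLift X t) := by
  obtain ⟨r, hr, e⟩ := h
  rw [← e, spinMap_real_mul]
  exact HasDirection.real_mul (exists_pos_mul_spin_chordLift hX t) hr

theorem le_of_cross_nonneg (hz : HasDirection z s) (hw : HasDirection w t) (h : s < t + 1)
    (hc : 0 ≤ cross z w) : s ≤ t := by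
  obtain ⟨r, hr, rfl⟩ := hz
  obtain ⟨r', hr', rfl⟩ := hw
  rw [cross_real_mul_left, cross_real_mul_right] at hc
  exact le_of_cross_spin_nonneg h
    (nonneg_of_mul_nonneg_right (nonneg_of_mul_nonneg_right hc hr) hr')

theorem lt_of_cross_pos (hz : HasDirection z s) (hw : HasDirection w t) (h : s < t + 1)
    (hc : 0 < cross z w) : s < t := by
  obtain ⟨r, hr, rfl⟩ := hz
  obtain ⟨r', hr', rfl⟩ := hw
  rw [cross_real_mul_left, cross_real_mul_right] at hc
  exact lt_of_cross_spin_pos h (pos_of_mul_pos_right (pos_of_mul_pos_right hc hr.le) hr'.le)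

theorem eq_of_cross_eq_zero (hz : HasDirection z s) (hw : HasDirection w t) (h : s < t + 1)
    (h' : t < s + 1) (hc : cross z w = 0) : s = t :=
  le_antisymm (hz.le_of_cross_nonneg hw h hc.ge)
    (hw.le_of_cross_nonneg hz h' (by rw [cross_anticomm, hc, neg_zero]))

end HasDirection

/-! ### The dynamics in the frame of a chord -/

/-- The Lorentzian discriminant of the line `XY`. -/
def disc (X Y : ℂ) : ℝ := gram X Y ^ 2 - gram X X * gram Y Y

/-- Twice the signed area of the triangle `PQR`. -/
def area (P Q R : ℂ) : ℝ := cross (Q - P) (R - P)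

/-- The points `P`, `Q` lie in this order on the oriented chord from parameter `a` to
parameter `b`, dividing it in the ratios `p` and `q`. -/
structure ChordFrame (P Q : ℂ) (a b p q : ℝ) : Prop where
  a_lt : a < b
  b_lt : b < a + 1
  p_pos : 0 < p
  p_lt : p < q
  q_lt : q < 1
  left : P = spin a ^ 2 + p * (spin b ^ 2 - spin a ^ 2)
  right : Q = spin a ^ 2 + q * (spin b ^ 2 - spin a ^ 2)

theorem spinMap_chord_left {a b p : ℝ} {P : ℂ}
    (h : P = spin a ^ 2 + p * (spin b ^ 2 - spin a ^ 2)) :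
    spinMap P (spin a) = ((2 * cross (spin a) (spin b) * p : ℝ) : ℂ) * spin b := by
  have ha := spin_re_sq_add_im_sq a
  have hb := spin_re_sq_add_im_sq b
  rw [h]
  generalize spin a = u at *
  generalize spin b = v at *
  apply Complex.ext
  · simp [spinMap_re, cross, pow_two]
    linear_combination (u.im * (1 - p)) * ha + p * u.im * hb
  · simp [spinMap_im, cross, pow_two]
    linear_combination (p * u.re - u.re) * ha - p * u.re * hb

theorem sq_spin_sub_sq_spin (a b : ℝ) :
    spin b ^ 2 - spin a ^ 2 =
      ((2 * cross (spin a) (spin b) : ℝ) : ℂ) * (I * spin a * spin b) := by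
  have ha := spin_re_sq_add_im_sq a
  have hb := spin_re_sq_add_im_sq b
  generalize spin a = u at *
  generalize spin b = v at *
  apply Complex.ext
  · simp [cross, pow_two]
    linear_combination (-(v.re ^ 2 - v.im ^ 2)) * ha + (u.re ^ 2 - u.im ^ 2) * hb
  · simp [cross, pow_two]
    linear_combination (-2 * v.re * v.im) * ha + 2 * u.re * u.im * hb

/-- The product is bilinear on the lifts to the cone, and the ends of the chord lift to null
vectors, so only the mixed term survives. -/
theorem gram_chord (a b p q : ℝ) :
    gram (spin a ^ 2 + p * (spin b ^ 2 - spin a ^ 2)) (spin a ^ 2 + q * (spin b ^ 2 - spin a ^ 2)) =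
      2 * cross (spin a) (spin b) ^ 2 * (q * (1 - p) + p * (1 - q)) := by
  have ha := spin_re_sq_add_im_sq a
  have hb := spin_re_sq_add_im_sq b
  generalize spin a = u at *
  generalize spin b = v at *
  have huu : gram (u ^ 2) (u ^ 2) = 0 := by
    simp [gram, pow_two]
    linear_combination (-(u.re ^ 2 + u.im ^ 2) - 1) * ha
  have hvv : gram (v ^ 2) (v ^ 2) = 0 := by
    simp [gram, pow_two]
    linear_combination (-(v.re ^ 2 + v.im ^ 2) - 1) * hb
  have huv : gram (u ^ 2) (v ^ 2) = 2 * cross u v ^ 2 := by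
    simp [gram, cross, pow_two]
    linear_combination (-(v.re ^ 2 + v.im ^ 2)) * ha - hb
  have e : gram (u ^ 2 + p * (v ^ 2 - u ^ 2)) (u ^ 2 + q * (v ^ 2 - u ^ 2)) =
      (1 - p) * (1 - q) * gram (u ^ 2) (u ^ 2) +
        (q * (1 - p) + p * (1 - q)) * gram (u ^ 2) (v ^ 2) + p * q * gram (v ^ 2) (v ^ 2) := by
    simp only [gram, add_re, add_im, re_ofReal_mul, im_ofReal_mul, sub_re, sub_im]
    ring
  rw [e, huu, hvv, huv]; ring

/-- Linear combination of the end vectors of a chord. -/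
def chordVec (a b x y : ℝ) : ℂ := x * spin a + y * spin b

theorem cross_chordVec (a b x y x' y' : ℝ) :
    cross (chordVec a b x y) (chordVec a b x' y') =
      cross (spin a) (spin b) * (x * y' - y * x') := by
  simp [cross, chordVec]; ring

theorem real_mul_chordVec (a b x y r : ℝ) :
    (r : ℂ) * chordVec a b x y = chordVec a b (r * x) (r * y) := by
  simp [chordVec]; ring

theorem neg_chordVec (a b x y : ℝ) : -chordVec a b x y = chordVec a b (-x) (-y) := by
  simp [chordVec]; ring

theorem spinMap_chordVec_of_eq {X : ℂ} {a b k l m n : ℝ}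
    (ha : spinMap X (spin a) = chordVec a b k l) (hb : spinMap X (spin b) = chordVec a b m n)
    (x y : ℝ) :
    spinMap X (chordVec a b x y) = chordVec a b (x * k + y * m) (x * l + y * n) := by
  have : spinMap X (chordVec a b x y) = x * spinMap X (spin a) + y * spinMap X (spin b) := by
    simp [spinMap, chordVec]; ring
  rw [this, ha, hb]
  simp [chordVec]; ring

/-- A point of the chord exchanges its two ends, so the matrix is antidiagonal. The second column is
the first one for the reversed chord. -/
theorem spinMap_chord {a b p : ℝ} {P : ℂ} (h : P = spin a ^ 2 + p * (spin b ^ 2 - spin a ^ 2))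
    (x y : ℝ) :
    spinMap P (chordVec a b x y) = ((2 * cross (spin a) (spin b) : ℝ) : ℂ) *
      chordVec a b (-((1 - p) * y)) (p * x) := by
  have h' : P = spin b ^ 2 + (1 - p : ℝ) * (spin a ^ 2 - spin b ^ 2) := by
    rw [h]; push_cast; ring
  have ha : spinMap P (spin a) = chordVec a b 0 (2 * cross (spin a) (spin b) * p) := by
    rw [spinMap_chord_left h]; simp [chordVec]
  have hb : spinMap P (spin b) = chordVec a b (-(2 * cross (spin a) (spin b) * (1 - p))) 0 := by
    rw [spinMap_chord_left h', cross_anticomm]; simp [chordVec]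
  rw [spinMap_chordVec_of_eq ha hb, real_mul_chordVec]
  congr 1 <;> ring

theorem eq_chordVec {a b : ℝ} (h : cross (spin a) (spin b) ≠ 0) (z : ℂ) :
    z = chordVec a b (cross z (spin b) / cross (spin a) (spin b))
      (cross (spin a) z / cross (spin a) (spin b)) := by
  apply Complex.ext <;>
  · simp only [chordVec, add_re, add_im, re_ofReal_mul, im_ofReal_mul]
    field_simp
    simp only [cross]; ring

/-- The matrix of the involution of a third point in the frame of a chord. -/
theorem ChordFrame.exists_matrix {P Q R : ℂ} {a b p q : ℝ} (hf : ChordFrame P Q a b p q)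
    (hR : ‖R‖ < 1) (harea : 0 < area P Q R) :
    ∃ κ β γ : ℝ, 0 < κ ∧ 0 < β ∧ 0 < γ ∧ β * γ = gram R R + κ ^ 2 ∧
      area P Q R = 2 * cross (spin a) (spin b) ^ 2 * κ * (q - p) ∧
      ∀ x y : ℝ, spinMap R (chordVec a b x y) =
        chordVec a b (-(κ * x) - γ * y) (β * x + κ * y) := by
  have hσ := cross_spin_pos hf.a_lt hf.b_lt
  have hua := spin_re_sq_add_im_sq a
  have hub := spin_re_sq_add_im_sq b
  have hna := norm_spin_sq a
  have hnb := norm_spin_sq b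
  have hA := eq_chordVec hσ.ne' (spinMap R (spin a))
  have hB := eq_chordVec hσ.ne' (spinMap R (spin b))
  have hpq := sub_pos.2 hf.p_lt
  set σ := cross (spin a) (spin b) with hσd
  have hβ : cross (spin a) (spinMap R (spin a)) = gram R (spin a ^ 2) := by
    simp [cross, spinMap_re, spinMap_im, gram, pow_two]; linear_combination hua
  have hγ : cross (spinMap R (spin b)) (spin b) = -gram R (spin b ^ 2) := by
    simp [cross, spinMap_re, spinMap_im, gram, pow_two]; linear_combination -hub
  -- Trace zero: the diagonal entries are opposite, so one `κ` describes both.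
  have hκ : cross (spin a) (spinMap R (spin b)) = -cross (spinMap R (spin a)) (spin b) := by
    simp [cross, spinMap_re, spinMap_im]; ring
  have hdet : cross (spinMap R (spin a)) (spinMap R (spin b)) = gram R R * σ := by
    simp [cross, spinMap_re, spinMap_im, gram, hσd]; ring
  have hD : area P Q R = 2 * σ * (-cross (spinMap R (spin a)) (spin b)) * (q - p) := by
    have e : area P Q R = (q - p) * cross (spin b ^ 2 - spin a ^ 2) (R - spin a ^ 2) := by
      rw [hf.left, hf.right, area]
      simp only [cross, add_re, add_im, re_ofReal_mul, im_ofReal_mul, sub_re, sub_im]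
      ring
    have e2 : cross (spin b ^ 2 - spin a ^ 2) (R - spin a ^ 2) =
        2 * σ * (-cross (spinMap R (spin a)) (spin b)) := by
      rw [hσd, sq_spin_sub_sq_spin, cross_real_mul_left]
      congr 1
      simp [cross, spinMap_re, spinMap_im, pow_two]
      linear_combination
        ((spin a).re * (spin b).re + (spin a).im * (spin b).im) * hua
    rw [e, e2]; ring
  have hκpos : 0 < -cross (spinMap R (spin a)) (spin b) := by
    rw [hD] at harea
    exact pos_of_mul_pos_right (pos_of_mul_pos_left harea hpq.le) (by positivity)
  refine ⟨-cross (spinMap R (spin a)) (spin b) / σ, gram R (spin a ^ 2) / σ,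
    gram R (spin b ^ 2) / σ, div_pos hκpos hσ, div_pos (gram_pos hR hna.le) hσ,
    div_pos (gram_pos hR hnb.le) hσ, ?_, ?_, ?_⟩
  · rw [hA, hB, cross_chordVec, hκ, hβ, hγ] at hdet
    rw [← hσd] at hdet
    field_simp at hdet ⊢
    linear_combination hdet
  · rw [hD]; field_simp
  · intro x y
    rw [spinMap_chordVec_of_eq hA hB, hκ, hβ, hγ]
    congr 1 <;> ring

section

variable {P Q R : ℂ} {a b p q : ℝ}

theorem hasDirection_chordVec_left (a b : ℝ) : HasDirection (chordVec a b 1 0) a := by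
  simpa [chordVec] using HasDirection.of_spin a

theorem hasDirection_chordVec_right (a b : ℝ) : HasDirection (chordVec a b 0 1) b := by
  simpa [chordVec] using HasDirection.of_spin b

namespace ChordFrame

theorem cross_pos (hf : ChordFrame P Q a b p q) : 0 < cross (spin a) (spin b) :=
  cross_spin_pos hf.a_lt hf.b_lt

theorem map_left (hf : ChordFrame P Q a b p q) (hP : ‖P‖ < 1) : chordLift P a = b := by
  have h := (hasDirection_chordVec_left a b).map hP
  rw [spinMap_chord hf.left] at h
  have h' := h.of_real_mul (by linarith [hf.cross_pos])
  have h1 := lt_chordLift P a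
  have h2 := chordLift_lt P a
  refine h'.eq_of_cross_eq_zero (hasDirection_chordVec_right a b) ?_ ?_ ?_
  · linarith [hf.a_lt]
  · linarith [hf.b_lt]
  · rw [cross_chordVec]; ring

theorem map_right (hf : ChordFrame P Q a b p q) (hQ : ‖Q‖ < 1) : chordLift Q a = b := by
  have h := (hasDirection_chordVec_left a b).map hQ
  rw [spinMap_chord hf.right] at h
  have h' := h.of_real_mul (by linarith [hf.cross_pos])
  have h1 := lt_chordLift Q a
  have h2 := chordLift_lt Q a
  refine h'.eq_of_cross_eq_zero (hasDirection_chordVec_right a b) ?_ ?_ ?_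
  · linarith [hf.a_lt]
  · linarith [hf.b_lt]
  · rw [cross_chordVec]; ring

/-- The determinant of the two images is a positive multiple of `x y (q - p)`. This decides between
`P` and `Q` in the minimum on the arc from `b` to `a + 1`. -/
theorem chordLift_left_le_right (hf : ChordFrame P Q a b p q) (hP : ‖P‖ < 1) (hQ : ‖Q‖ < 1)
    {x y t : ℝ} (hx : 0 ≤ x) (hy : 0 ≤ y) (h : HasDirection (chordVec a b (-x) y) t) :
    chordLift P t ≤ chordLift Q t := by
  have h1 := h.map hP
  have h2 := h.map hQ
  have hσ := hf.cross_pos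
  rw [spinMap_chord hf.left] at h1
  rw [spinMap_chord hf.right] at h2
  refine (h1.of_real_mul (by linarith)).le_of_cross_nonneg (h2.of_real_mul (by linarith)) ?_ ?_
  · linarith [chordLift_lt P t, lt_chordLift Q t]
  · rw [cross_chordVec]
    have : 0 ≤ cross (spin a) (spin b) * (x * y * (q - p)) := by
      have := sub_pos.2 hf.p_lt
      positivity
    linarith

end ChordFrame

/-- Two boundary orbits of the chord `PQ` meet within two turns in the order determined by the
sign of a quadratic form. -/
theorem ChordFrame.fifth_iterate (hf : ChordFrame P Q a b p q) (hP : ‖P‖ < 1) (hQ : ‖Q‖ < 1)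
    (hR : ‖R‖ < 1) {κ β γ : ℝ} (hκ : 0 < κ) (hβ : 0 < β) (hγ : 0 < γ)
    (hM : ∀ x y : ℝ, spinMap R (chordVec a b x y) =
        chordVec a b (-(κ * x) - γ * y) (β * x + κ * y)) :
    ∃ w, (κ ^ 2 * (q * (1 - p)) ≤ β * γ * (p * (1 - q)) → w + 2 ≤ (triangleLift P Q R)^[5] w) ∧
      (β * γ * (p * (1 - q)) ≤ κ ^ 2 * (q * (1 - p)) → (triangleLift P Q R)^[5] w ≤ w + 2) := by
  have hσ := hf.cross_pos
  have hab := hf.a_lt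
  have hba := hf.b_lt
  have mP := strictMono_chordLift hP
  have mQ := strictMono_chordLift hQ
  have mR := strictMono_chordLift hR
  have hPa := hf.map_left hP
  have hQa := hf.map_right hQ
  have hPb : chordLift P b = a + 1 := by rw [← hPa, chordLift_chordLift hP]
  have hQb : chordLift Q b = a + 1 := by rw [← hQa, chordLift_chordLift hQ]
  have dRa := (hasDirection_chordVec_left a b).map hR
  have dRb := (hasDirection_chordVec_right a b).map hR
  rw [hM] at dRa dRb
  have hRa : b < chordLift R a := by
    refine (hasDirection_chordVec_right a b).lt_of_cross_pos dRa ?_ ?_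
    · linarith [lt_chordLift R a]
    · rw [cross_chordVec]; nlinarith [mul_pos hσ hκ]
  have hRa' := chordLift_lt R a
  have hRb := lt_chordLift R b
  have hRb' : chordLift R b < a + 1 := by
    rw [← chordLift_chordLift hR a]; exact mR hRa
  -- The orbit is built around the step `a ↦ b` along the chord: forward from `b` through `R` to
  -- `c`, backward from `a` through `R` to `a'` and then through `Q` to `w`.
  set c := chordLift R b with hc
  set a' := chordLift R a - 1 with ha'
  have hRc : chordLift R c = b + 1 := chordLift_chordLift hR b
  have hRa'' : chordLift R a' = a := by
    rw [ha', chordLift_sub_one, chordLift_chordLift hR]; ring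
  set w := chordLift Q a' - 1 with hw
  have hPw : ∀ X, ‖X‖ < 1 → chordLift X a' ≤ chordLift Q a' → a' ≤ chordLift X w := by
    intro X hX h
    have := (strictMono_chordLift hX).monotone h
    rw [chordLift_chordLift hX] at this
    rw [hw, chordLift_sub_one]; linarith
  have hF : ∀ t, triangleLift P Q R t =
    min (chordLift P t) (min (chordLift Q t) (chordLift R t)) := fun _ => rfl
  have hQw : chordLift Q w = a' := by
    rw [hw, chordLift_sub_one, chordLift_chordLift hQ]; ring
  have ha'b : b - 1 < a' := by linarith
  have hQa' : a < chordLift Q a' := by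
    have := mQ ha'b
    rw [chordLift_sub_one, hQb] at this; linarith
  have hPa' : a < chordLift P a' := by
    have := mP ha'b
    rw [chordLift_sub_one, hPb] at this; linarith
  have F1 : triangleLift P Q R w = a' := by
    have h1 : chordLift P a' ≤ chordLift Q a' := by
      have := hf.chordLift_left_le_right hP hQ (x := κ) (y := β) hκ.le hβ.le (t := a' + 1)
        (by rw [ha', sub_add_cancel]; simpa using dRa)
      simpa [chordLift_add_one] using this
    have h2 := hPw P hP h1
    have h3 := hPw R hR (by rw [hRa'']; exact hQa'.le)
    rw [hF, hQw, min_eq_left h3, min_eq_right h2]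
  have F2 : triangleLift P Q R a' = a := by
    rw [hF, hRa'', min_eq_right hQa'.le, min_eq_right hPa'.le]
  have F3 : triangleLift P Q R a = b := by
    rw [hF, hPa, hQa, min_eq_left hRa.le, min_self]
  have F4 : triangleLift P Q R b = c := by
    rw [hF, hPb, hQb, ← hc, min_eq_right hRb'.le, min_eq_right hRb'.le]
  have F5 : triangleLift P Q R c = chordLift P c := by
    have h1 : chordLift P c ≤ chordLift Q c :=
      hf.chordLift_left_le_right hP hQ (x := γ) (y := κ) hγ.le hκ.le (by simpa using dRb)
    have h2 : chordLift P c ≤ chordLift R c := by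
      have := mP hRb'
      rw [chordLift_add_one, hPa] at this
      rw [hRc]; exact this.le
    rw [hF, min_eq_left (le_min h1 h2)]
  have hiter : (triangleLift P Q R)^[5] w = chordLift P c := by
    simp only [Function.iterate_succ, Function.iterate_zero, Function.comp, id, F1, F2, F3, F4, F5]
  have hPc : a + 1 < chordLift P c := by rw [← hPb]; exact mP hRb
  have hPc' : chordLift P c < b + 1 := by
    have := mP hRb'
    rwa [chordLift_add_one, hPa] at this
  -- This puts both quantities to be compared in the same form: `P` after `R` at `b` against `Q`
  -- after `R` at `a`.
  have hw2 : w + 2 = chordLift Q (chordLift R a) := by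
    rw [hw, ha', chordLift_sub_one]; ring
  have hQc : a + 1 < chordLift Q (chordLift R a) := by rw [← hQb]; exact mQ hRa
  have hQc' : chordLift Q (chordLift R a) < b + 1 := by
    have := mQ hRa'
    rwa [chordLift_add_one, hQa] at this
  have dP := dRb.map hP
  have dQ := dRa.map hQ
  rw [spinMap_chord hf.left] at dP
  rw [spinMap_chord hf.right] at dQ
  have dP' := dP.of_real_mul (by linarith)
  have dQ' := dQ.of_real_mul (by linarith)
  refine ⟨w, fun h => ?_, fun h => ?_⟩
  · rw [hiter, hw2]
    refine dQ'.le_of_cross_nonneg dP' (by linarith) ?_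
    rw [cross_chordVec]
    have := mul_nonneg hσ.le (sub_nonneg.2 h)
    linarith
  · rw [hiter, hw2]
    refine dP'.le_of_cross_nonneg dQ' (by linarith) ?_
    rw [cross_chordVec]
    have := mul_nonneg hσ.le (sub_nonneg.2 h)
    linarith

/-- `Q` after `P` is a hyperbolic translation along the chord: the product of two antidiagonal
matrices is diagonal. Both carry a sign, so the product is negative, which the shift by one undoes.
-/
theorem ChordFrame.chordLift_chordLift_mem (hf : ChordFrame P Q a b p q) (hP : ‖P‖ < 1)
    (hQ : ‖Q‖ < 1) {t x y : ℝ} (ht : t ∈ Set.Ioo b (a + 1))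
    (h : HasDirection (chordVec a b (-x) y) t) :
    chordLift Q (chordLift P t) - 1 ∈ Set.Ioo b (a + 1) ∧
      HasDirection (chordVec a b (-((p * (1 - q)) * x)) (q * (1 - p) * y))
        (chordLift Q (chordLift P t) - 1) := by
  have hσ := hf.cross_pos
  have hPa := hf.map_left hP
  have hQa := hf.map_right hQ
  have hPb : chordLift P b = a + 1 := by rw [← hPa, chordLift_chordLift hP]
  have hQb : chordLift Q b = a + 1 := by rw [← hQa, chordLift_chordLift hQ]
  refine ⟨⟨?_, ?_⟩, ?_⟩
  · have := strictMono_chordLift hQ (strictMono_chordLift hP ht.1)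
    rw [hPb, chordLift_add_one, hQa] at this; linarith
  · have := strictMono_chordLift hQ (strictMono_chordLift hP ht.2)
    rw [chordLift_add_one, hPa, chordLift_add_one, hQb] at this; linarith
  · have h1 := (h.map hP)
    rw [spinMap_chord hf.left] at h1
    have h2 := (h1.of_real_mul (by linarith)).map hQ
    rw [spinMap_chord hf.right] at h2
    have h3 := (h2.of_real_mul (by linarith)).neg_sub_one
    rw [neg_chordVec] at h3
    convert h3 using 2 <;> ring

theorem exists_hasDirection_chordVec {a b x y : ℝ} (hab : a < b) (hba : b < a + 1) (hx : 0 < x)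
    (hy : 0 < y) : ∃ t ∈ Set.Ioo b (a + 1), HasDirection (chordVec a b (-x) y) t := by
  have hσ := cross_spin_pos hab hba
  obtain ⟨t, ht, e⟩ := exists_spin_eq (chordVec a b (-x) y) a
  have hne : chordVec a b (-x) y ≠ 0 := fun h0 => by
    have := cross_chordVec a b 1 0 (-x) y
    rw [h0] at this
    simp [cross] at this
    rcases this with h | h
    · simp only [cross] at hσ; exact hσ.ne' h
    · exact hy.ne' h
  have d : HasDirection (chordVec a b (-x) y) t := ⟨_, norm_pos_iff.2 hne, e⟩
  have h1 : t < a + 1 := by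
    -- Otherwise the opposite vector has parameter `t - 1 ≥ a`, the determinant with `spin a` forces
    -- equality, and then that determinant vanishes although `y > 0`.
    by_contra! hlt
    have d' : HasDirection (chordVec a b (-(-x)) (-y)) (t - 1) := by
      rw [← neg_chordVec]; exact d.neg_sub_one
    have := d'.le_of_cross_nonneg (hasDirection_chordVec_left a b) (by linarith [ht.2])
      (by rw [cross_chordVec]; have := mul_pos hσ hy; linarith)
    have hta : t = a + 1 := by linarith
    have h0 := cross_chordVec a b (-x) y 1 0
    rw [← e, cross_real_mul_left, hta, spin_add_one] at h0
    have : 0 < cross (spin a) (spin b) * y := by positivity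
    simp [chordVec, cross] at h0 this
    grind
  refine ⟨t, ⟨?_, h1⟩, d⟩
  refine (hasDirection_chordVec_right a b).lt_of_cross_pos d (by linarith [ht.1]) ?_
  rw [cross_chordVec]; have := mul_pos hσ hx; linarith

/-- Replacing the minimum by one vertex at a time bounds `F⁵` above by `R` after two translations `Q
∘ P`. The hypothesis says that the quadratic form comparing this bound with `v + 2` is nonnegative
at a suitable vector. -/
theorem ChordFrame.exists_iterate_le (hf : ChordFrame P Q a b p q) (hP : ‖P‖ < 1) (hQ : ‖Q‖ < 1)
    (hR : ‖R‖ < 1) {κ β γ : ℝ} (hκ : 0 < κ) (hβ : 0 < β) (hγ : 0 < γ)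
    (hM : ∀ x y : ℝ, spinMap R (chordVec a b x y) =
        chordVec a b (-(κ * x) - γ * y) (β * x + κ * y))
    (h : 4 * (p * (1 - q)) ^ 2 * (q * (1 - p)) ^ 2 * (β * γ) ≤
      κ ^ 2 * ((p * (1 - q)) ^ 2 + (q * (1 - p)) ^ 2) ^ 2) :
    ∃ v, (triangleLift P Q R)^[5] v ≤ v + 2 := by
  have hσ := hf.cross_pos
  have hp := hf.p_pos
  have hq : 0 < q := hp.trans hf.p_lt
  have hq' := sub_pos.2 hf.q_lt
  have hp' : 0 < 1 - p := by linarith [hf.p_lt]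
  have hYX : p * (1 - q) < q * (1 - p) := by linarith [hf.p_lt]
  set Y := p * (1 - q) with hY
  set X := q * (1 - p) with hX
  have hY0 : 0 < Y := by positivity
  have hX0 : 0 < X := by positivity
  set s := Real.sqrt β with hs
  set g := Real.sqrt γ with hg
  have hs0 : 0 < s := Real.sqrt_pos.2 hβ
  have hg0 : 0 < g := Real.sqrt_pos.2 hγ
  have hs2 : s ^ 2 = β := Real.sq_sqrt hβ.le
  have hg2 : g ^ 2 = γ := Real.sq_sqrt hγ.le
  -- On `(-x, y)` the form is `κ(X² + Y²)xy - βY²x² - γX²y²`. The choice `x = X√γ`, `y = Y√β` is the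
  -- equality case of the arithmetic–geometric mean inequality for the last two terms.
  obtain ⟨v, hv, dv⟩ := exists_hasDirection_chordVec hf.a_lt hf.b_lt (mul_pos hX0 hg0)
    (mul_pos hY0 hs0)
  obtain ⟨hv1, dv1⟩ := hf.chordLift_chordLift_mem hP hQ hv dv
  obtain ⟨hv2, dv2⟩ := hf.chordLift_chordLift_mem hP hQ hv1 dv1
  set v1 := chordLift Q (chordLift P v) - 1 with hv1d
  set u := chordLift Q (chordLift P v1) - 1 with hud
  have huv : u < v := by
    refine dv2.lt_of_cross_pos dv (by linarith [hv2.2, hv.1, hf.a_lt]) ?_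
    rw [cross_chordVec, ← hY, ← hX]
    have : 0 < cross (spin a) (spin b) * (X * g * (Y * s) * ((X - Y) * (X + Y))) := by
      have := sub_pos.2 hYX
      positivity
    linarith
  have dR := dv2.map hR
  rw [hM] at dR
  have hk : 2 * (s * g) * (X * Y) ≤ κ * (X ^ 2 + Y ^ 2) := by
    refine le_of_sq_le_sq ?_ (by positivity)
    rw [← hs2, ← hg2] at h
    linarith
  have hle : chordLift R u ≤ v := by
    refine dR.le_of_cross_nonneg dv (by linarith [chordLift_lt R u]) ?_
    rw [cross_chordVec, ← hY, ← hX, ← hs2, ← hg2]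
    have : 0 ≤ cross (spin a) (spin b) *
        (X * Y * (s * g) * (κ * (X ^ 2 + Y ^ 2) - 2 * (s * g) * (X * Y))) := by
      have := sub_nonneg.2 hk
      positivity
    linarith
  refine ⟨v, ?_⟩
  have mF := (strictMono_triangleLift hP hQ hR).monotone
  have hFP : ∀ t, triangleLift P Q R t ≤ chordLift P t := fun t => min_le_left _ _
  have hFQ : ∀ t, triangleLift P Q R t ≤ chordLift Q t :=
    fun t => (min_le_right _ _).trans (min_le_left _ _)
  have hFR : ∀ t, triangleLift P Q R t ≤ chordLift R t :=
    fun t => (min_le_right _ _).trans (min_le_right _ _)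
  have hQP : ∀ t, triangleLift P Q R (triangleLift P Q R t) ≤ chordLift Q (chordLift P t) :=
    fun t => (mF (hFP t)).trans (hFQ _)
  have e1 : triangleLift P Q R (triangleLift P Q R v) ≤ v1 + 1 := by
    rw [hv1d, sub_add_cancel]; exact hQP v
  have e2 : triangleLift P Q R (triangleLift P Q R (v1 + 1)) ≤ u + 1 + 1 := by
    refine (hQP _).trans ?_
    rw [chordLift_add_one, chordLift_add_one, hud, sub_add_cancel]
  have e3 := mF ((mF (mF e1)).trans e2)
  have e4 := e3.trans (hFR (u + 1 + 1))
  rw [chordLift_add_one, chordLift_add_one] at e4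
  have e5 : (triangleLift P Q R)^[5] v = triangleLift P Q R (triangleLift P Q R
    (triangleLift P Q R (triangleLift P Q R (triangleLift P Q R v)))) := rfl
  rw [e5]; linarith

end

/-! ### Klein distances in terms of the Lorentzian product -/

theorem exists_sq_spin_eq {z : ℂ} (hz : ‖z‖ = 1) : ∃ t, spin t ^ 2 = z := by
  refine ⟨z.arg / (2 * Real.pi), ?_⟩
  have hpi := Real.pi_ne_zero
  rw [← coe_circle_exp, mul_div_cancel₀ _ (by positivity : 2 * Real.pi ≠ 0), Circle.coe_exp]
  have := Complex.norm_mul_exp_arg_mul_I z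
  rwa [hz, ofReal_one, one_mul] at this

theorem exists_sq_spin_eq_of_ne {z : ℂ} (hz : ‖z‖ = 1) {a : ℝ} (ha : z ≠ spin a ^ 2) :
    ∃ t, a < t ∧ t < a + 1 ∧ spin t ^ 2 = z := by
  obtain ⟨t, ht⟩ := exists_sq_spin_eq hz
  have hm := toIocMod_mem_Ioc (zero_lt_one' ℝ) a t
  have e : spin (toIocMod (zero_lt_one' ℝ) a t) ^ 2 = z := by
    rw [← ht, ← coe_circle_exp, ← coe_circle_exp, toIocMod, zsmul_eq_mul, mul_one, mul_sub,
      mul_comm _ (Int.cast _ : ℝ), Circle.periodic_exp.sub_int_mul_eq]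
  refine ⟨_, hm.1, lt_of_le_of_ne hm.2 fun h => ha ?_, e⟩
  rw [← e, h, spin_add_one, neg_sq]

/-- Two points of the disk in the frame of their chord, with the Klein distance. -/
theorem exists_chordFrame {P Q : ℂ} (hP : ‖P‖ < 1) (hQ : ‖Q‖ < 1) (hne : P ≠ Q) :
    ∃ a b p q, ChordFrame P Q a b p q ∧
      Real.exp (2 * kleinDist P Q) = q * (1 - p) / (p * (1 - q)) := by
  have hs := one_lt_exitParam hQ hne
  have hs' := one_lt_exitParam hP hne.symm
  have hB := norm_exitPoint hP hne
  have hA := norm_exitPoint hQ hne.symm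
  have hV : 0 < ‖Q - P‖ := norm_pos_iff.2 (sub_ne_zero.2 hne.symm)
  have hAe : exitPoint Q P = P + ((1 - exitParam Q P : ℝ) : ℂ) * (Q - P) := by
    rw [exitPoint]; push_cast; ring
  have hBe : exitPoint P Q = P + (exitParam P Q : ℂ) * (Q - P) := rfl
  have hk : kleinDist P Q = 1 / 2 * |Real.log
    ((dist (exitPoint Q P) Q * dist (exitPoint P Q) P) /
      (dist (exitPoint Q P) P * dist (exitPoint P Q) Q))| := if_neg hne
  set s := exitParam P Q
  set s' := exitParam Q P
  have hG : 0 < s + s' - 1 := by linarith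
  have d1 : dist (exitPoint Q P) Q = s' * ‖Q - P‖ := by
    rw [hAe, dist_eq_norm,
      show P + ((1 - s' : ℝ) : ℂ) * (Q - P) - Q = ((-s' : ℝ) : ℂ) * (Q - P) by push_cast; ring,
      norm_mul, Complex.norm_real, Real.norm_eq_abs, abs_neg, abs_of_pos (by linarith)]
  have d2 : dist (exitPoint P Q) P = s * ‖Q - P‖ := by
    rw [hBe, dist_eq_norm, add_sub_cancel_left, norm_mul, Complex.norm_real, Real.norm_eq_abs,
      abs_of_pos (by linarith)]
  have d3 : dist (exitPoint Q P) P = (s' - 1) * ‖Q - P‖ := by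
    rw [hAe, dist_eq_norm, add_sub_cancel_left, norm_mul, Complex.norm_real, Real.norm_eq_abs,
      abs_of_neg (by linarith)]
    ring
  have d4 : dist (exitPoint P Q) Q = (s - 1) * ‖Q - P‖ := by
    rw [hBe, dist_eq_norm,
      show P + (s : ℂ) * (Q - P) - Q = ((s - 1 : ℝ) : ℂ) * (Q - P) by push_cast; ring,
      norm_mul, Complex.norm_real, Real.norm_eq_abs, abs_of_pos (by linarith)]
  obtain ⟨a, ha⟩ := exists_sq_spin_eq hA
  have hAB : exitPoint P Q - exitPoint Q P = ((s + s' - 1 : ℝ) : ℂ) * (Q - P) := by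
    rw [hAe, hBe]; push_cast; ring
  have hABne : exitPoint P Q ≠ spin a ^ 2 := by
    rw [ha, ← sub_ne_zero, hAB]
    exact mul_ne_zero (by exact_mod_cast hG.ne') (sub_ne_zero.2 hne.symm)
  obtain ⟨b, hab, hba, hb⟩ := exists_sq_spin_eq_of_ne hB hABne
  have hGC : ((s + s' - 1 : ℝ) : ℂ) ≠ 0 := by exact_mod_cast hG.ne'
  have hpt : ∀ x : ℝ, spin a ^ 2 + ((x / (s + s' - 1) : ℝ) : ℂ) * (spin b ^ 2 - spin a ^ 2) =
      P + ((1 - s' + x : ℝ) : ℂ) * (Q - P) := by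
    intro x
    rw [ha, hb, hAB, hAe, ← mul_assoc, ← ofReal_mul, div_mul_cancel₀ _ hG.ne']
    push_cast; ring
  -- With `P` at 0 and `Q` at 1 on their line, the ends of the chord are at `1 - s'` and `s`;
  -- rescaling that interval to `[0, 1]` gives the two ratios.
  refine ⟨a, b, (s' - 1) / (s + s' - 1), s' / (s + s' - 1),
    ⟨hab, hba, div_pos (by linarith) hG, by gcongr; linarith, (div_lt_one hG).2 (by linarith),
      ?_, ?_⟩, ?_⟩
  · rw [hpt]; simp
  · rw [hpt]; simp
  · rw [hk, d1, d2, d3, d4]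
    have h1 : 0 < s' - 1 := by linarith
    have h2 : 0 < s - 1 := by linarith
    have e : s' * ‖Q - P‖ * (s * ‖Q - P‖) / ((s' - 1) * ‖Q - P‖ * ((s - 1) * ‖Q - P‖)) =
        s' * s / ((s' - 1) * (s - 1)) := by
      field_simp
    have h3 : 1 < s' * s / ((s' - 1) * (s - 1)) := by
      rw [one_lt_div (by positivity)]; nlinarith
    rw [e, abs_of_pos (Real.log_pos h3), ← mul_assoc, mul_one_div_cancel two_ne_zero, one_mul,
      Real.exp_log (by linarith)]
    have e1 : 1 - (s' - 1) / (s + s' - 1) = s / (s + s' - 1) := by field_simp; ring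
    have e2 : 1 - s' / (s + s' - 1) = (s - 1) / (s + s' - 1) := by field_simp; ring
    rw [e1, e2]
    field_simp

theorem kleinDist_nonneg (P Q : ℂ) : 0 ≤ kleinDist P Q := by
  unfold kleinDist
  split_ifs <;> positivity

namespace ChordFrame

variable {P Q : ℂ} {a b p q : ℝ}

theorem gram_eq (hf : ChordFrame P Q a b p q) :
    gram P Q = 2 * cross (spin a) (spin b) ^ 2 * (q * (1 - p) + p * (1 - q)) := by
  rw [← gram_chord, ← hf.left, ← hf.right]

theorem gram_left_eq (hf : ChordFrame P Q a b p q) :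
    gram P P = 4 * cross (spin a) (spin b) ^ 2 * (p * (1 - p)) := by
  have := gram_chord a b p p
  rw [← hf.left] at this
  rw [this]; ring

theorem gram_right_eq (hf : ChordFrame P Q a b p q) :
    gram Q Q = 4 * cross (spin a) (spin b) ^ 2 * (q * (1 - q)) := by
  have := gram_chord a b q q
  rw [← hf.right] at this
  rw [this]; ring

theorem disc_eq (hf : ChordFrame P Q a b p q) :
    disc P Q = 4 * cross (spin a) (spin b) ^ 4 * (q - p) ^ 2 := by
  rw [disc, hf.gram_eq, hf.gram_left_eq, hf.gram_right_eq]; ring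

end ChordFrame

theorem disc_pos {P Q : ℂ} (hP : ‖P‖ < 1) (hQ : ‖Q‖ < 1) (hne : P ≠ Q) : 0 < disc P Q := by
  obtain ⟨a, b, p, q, hf, -⟩ := exists_chordFrame hP hQ hne
  have := hf.cross_pos
  have := sub_pos.2 hf.p_lt
  rw [hf.disc_eq]; positivity

/-- The hyperboloid formula for distance. The cross-ratio gives `e^{2d'}`, so the half-argument
identity for `cosh²` finishes. -/
theorem cosh_sq_kleinDist {P Q : ℂ} (hP : ‖P‖ < 1) (hQ : ‖Q‖ < 1) :
    Real.cosh (kleinDist P Q) ^ 2 = gram P Q ^ 2 / (gram P P * gram Q Q) := by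
  rcases eq_or_ne P Q with rfl | hne
  · have := gram_self_pos hP
    rw [kleinDist, if_pos rfl, Real.cosh_zero]
    field_simp
  · obtain ⟨a, b, p, q, hf, h⟩ := exists_chordFrame hP hQ hne
    have hσ := hf.cross_pos
    have hp := hf.p_pos
    have hq := hp.trans hf.p_lt
    have hq' := sub_pos.2 hf.q_lt
    have hp' : 0 < 1 - p := by linarith [hf.p_lt]
    rw [hf.gram_eq, hf.gram_left_eq, hf.gram_right_eq, Real.cosh_sq', ← sub_eq_zero]
    have e : 1 + Real.sinh (kleinDist P Q) ^ 2 = (Real.cosh (2 * kleinDist P Q) + 1) / 2 := by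
      rw [Real.cosh_two_mul, Real.cosh_sq]; ring
    rw [e, Real.cosh_eq, Real.exp_neg, h]
    field_simp
    ring

theorem sinh_sq_kleinDist {P Q : ℂ} (hP : ‖P‖ < 1) (hQ : ‖Q‖ < 1) :
    Real.sinh (kleinDist P Q) ^ 2 = disc P Q / (gram P P * gram Q Q) := by
  have h := cosh_sq_kleinDist hP hQ
  have := gram_self_pos hP
  have := gram_self_pos hQ
  rw [Real.cosh_sq] at h
  rw [eq_sub_of_add_eq h, disc]
  field_simp

theorem kleinDist_pos {P Q : ℂ} (hP : ‖P‖ < 1) (hQ : ‖Q‖ < 1) (hne : P ≠ Q) :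
    0 < kleinDist P Q := by
  refine lt_of_le_of_ne (kleinDist_nonneg P Q) fun h => ?_
  have := sinh_sq_kleinDist hP hQ
  rw [← h, Real.sinh_zero] at this
  have h1 := gram_self_pos hP
  have h2 := gram_self_pos hQ
  have h3 := disc_pos hP hQ hne
  have : 0 < disc P Q / (gram P P * gram Q Q) := by positivity
  linarith

/-! ### The distance from a point to a line -/

/-- The square that measures how far the point `P + x (Q - P)` is from the foot of the
perpendicular dropped from `R` to the line `PQ`. -/
theorem gram_sq_mul_disc_sub (P Q R : ℂ) (x : ℝ) {S V : ℂ} (hV : V = Q - P)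
    (hS : S = P + (x : ℂ) * V) :
    gram R S ^ 2 * disc P Q - gram S S * (gram R R * disc P Q + area P Q R ^ 2) =
      (gram R S * (S.re * V.re + S.im * V.im) - gram S S * (R.re * V.re + R.im * V.im)) ^ 2 := by
  have hP : P = S - (x : ℂ) * V := by rw [hS]; ring
  have hQ : Q = S + ((1 - x : ℝ) : ℂ) * V := by
    rw [show Q = P + V by rw [hV]; ring, hP]; push_cast; ring
  have e1 : disc P Q = V.re ^ 2 + V.im ^ 2 - cross S V ^ 2 := by
    rw [hP, hQ]
    simp only [disc, gram, cross, add_re, add_im, re_ofReal_mul, im_ofReal_mul, sub_re, sub_im]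
    ring
  have e2 : area P Q R = cross V (R - S) := by
    rw [area, ← hV, hP]
    simp only [cross, re_ofReal_mul, im_ofReal_mul, sub_re, sub_im]
    ring
  rw [e1, e2]
  simp only [gram, cross, sub_re, sub_im]
  ring

theorem exists_foot {P Q R : ℂ} (hP : ‖P‖ < 1) (hQ : ‖Q‖ < 1) (hR : ‖R‖ < 1) (hne : P ≠ Q) :
    ∃ x : ℝ, ‖P + (x : ℂ) * (Q - P)‖ < 1 ∧
      gram R (P + x * (Q - P)) ^ 2 * disc P Q =
        gram (P + x * (Q - P)) (P + x * (Q - P)) * (gram R R * disc P Q + area P Q R ^ 2) := by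
  obtain ⟨a, b, p, q, hf, -⟩ := exists_chordFrame hP hQ hne
  have hσ := hf.cross_pos
  have hpq := sub_pos.2 hf.p_lt
  have hgA := gram_pos hR (norm_spin_sq a).le
  have hgB := gram_pos hR (norm_spin_sq b).le
  set gA := gram R (spin a ^ 2) with hgAd
  set gB := gram R (spin b ^ 2) with hgBd
  set W := spin b ^ 2 - spin a ^ 2 with hW
  have hV : Q - P = ((q - p : ℝ) : ℂ) * W := by
    rw [hf.left, hf.right]; push_cast; ring
  -- The foot balances the Lorentzian products of `R` with the two ends; this ratio makes the square
  -- in `gram_sq_mul_disc_sub` vanish.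
  set s := gA / (gA + gB) with hs
  have hs1 : 1 - s = gB / (gA + gB) := by rw [hs]; field_simp; ring
  have hS : P + (((s - p) / (q - p) : ℝ) : ℂ) * (Q - P) = spin a ^ 2 + s * W := by
    rw [hV, ← mul_assoc, ← ofReal_mul, div_mul_cancel₀ _ hpq.ne']
    nth_rw 1 [hf.left]
    push_cast; ring
  have hn := gram_chord a b s s
  rw [← hW] at hn
  have hnpos : 0 < gram (spin a ^ 2 + s * W) (spin a ^ 2 + s * W) := by
    rw [hn, hs1, hs]; positivity
  have hRW : R.re * W.re + R.im * W.im = gA - gB := by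
    rw [hgAd, hgBd, hW]; simp only [gram, sub_re, sub_im]; ring
  have hRS : gram R (spin a ^ 2 + s * W) = (1 - s) * gA + s * gB := by
    rw [hgAd, hgBd, hW]
    simp only [gram, add_re, add_im, re_ofReal_mul, im_ofReal_mul, sub_re, sub_im]; ring
  have hSW : (spin a ^ 2 + s * W).re * W.re + (spin a ^ 2 + s * W).im * W.im =
      2 * cross (spin a) (spin b) ^ 2 * (2 * s - 1) := by
    have h0 := gram_chord a b s 0
    have h1 := gram_chord a b s 1
    rw [← hW] at h0 h1
    have : gram (spin a ^ 2 + s * W) (spin a ^ 2 + (0 : ℝ) * W) -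
        gram (spin a ^ 2 + s * W) (spin a ^ 2 + (1 : ℝ) * W) =
          (spin a ^ 2 + s * W).re * W.re + (spin a ^ 2 + s * W).im * W.im := by
      simp only [gram, add_re, add_im, re_ofReal_mul, im_ofReal_mul]; ring
    rw [← this, h0, h1]; ring
  refine ⟨(s - p) / (q - p), ?_, ?_⟩
  · rw [hS]
    rw [gram_self] at hnpos
    nlinarith [norm_nonneg (spin a ^ 2 + s * W)]
  · have h := gram_sq_mul_disc_sub P Q R ((s - p) / (q - p)) rfl rfl
    rw [hS] at h ⊢
    have hz : gram R (spin a ^ 2 + s * W) * ((spin a ^ 2 + s * W).re * W.re +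
        (spin a ^ 2 + s * W).im * W.im) - gram (spin a ^ 2 + s * W) (spin a ^ 2 + s * W) *
          (R.re * W.re + R.im * W.im) = 0 := by
      rw [hRW, hRS, hSW, hn, hs1, hs]
      field_simp
      ring
    rw [hV, re_ofReal_mul, im_ofReal_mul] at h
    refine sub_eq_zero.1 (h.trans ?_)
    rw [pow_eq_zero_iff two_ne_zero]
    linear_combination (q - p) * hz

/-- Nonnegativity of the square in `gram_sq_mul_disc_sub` bounds `cosh²` of every distance from `R`
to the line from below, with equality at the foot, so the infimum is attained. -/
theorem sinh_sq_lineDist {P Q R : ℂ} (hP : ‖P‖ < 1) (hQ : ‖Q‖ < 1) (hR : ‖R‖ < 1) (hne : P ≠ Q) :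
    0 ≤ lineDist P Q R ∧
      Real.sinh (lineDist P Q R) ^ 2 = area P Q R ^ 2 / (gram R R * disc P Q) := by
  have hE := disc_pos hP hQ hne
  have hn := gram_self_pos hR
  have hmem : ∀ S : ℂ, S ∈ line[ℝ, P, Q] ↔ ∃ x : ℝ, S = P + (x : ℂ) * (Q - P) := by
    intro S
    rw [mem_affineSpan_pair_iff_exists_lineMap_eq]
    refine exists_congr fun x => ?_
    rw [AffineMap.lineMap_apply, vsub_eq_sub, vadd_eq_add, real_smul, add_comm, eq_comm]
  obtain ⟨x, hx, hfoot⟩ := exists_foot hP hQ hR hne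
  set S := P + (x : ℂ) * (Q - P) with hS
  have hnS := gram_self_pos hx
  have hcosh : Real.cosh (kleinDist R S) ^ 2 =
      (gram R R * disc P Q + area P Q R ^ 2) / (gram R R * disc P Q) := by
    rw [cosh_sq_kleinDist hR hx]
    field_simp
    linear_combination hfoot
  have hleast : IsLeast {d : ℝ | ∃ S : ℂ, S ∈ line[ℝ, P, Q] ∧ ‖S‖ < 1 ∧ d = kleinDist R S}
      (kleinDist R S) := by
    refine ⟨⟨S, (hmem S).2 ⟨x, rfl⟩, hx, rfl⟩, ?_⟩
    rintro _ ⟨T, hT, hT1, rfl⟩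
    obtain ⟨y, hy⟩ := (hmem T).1 hT
    have hnT := gram_self_pos hT1
    have h := gram_sq_mul_disc_sub P Q R y rfl hy
    have hle : Real.cosh (kleinDist R S) ^ 2 ≤ Real.cosh (kleinDist R T) ^ 2 := by
      rw [hcosh, cosh_sq_kleinDist hR hT1, div_le_div_iff₀ (by positivity) (by positivity)]
      have hsq := sub_nonneg.1 ((sq_nonneg _).trans_eq h.symm)
      have := mul_le_mul_of_nonneg_left hsq hn.le
      linarith
    have h2 := (pow_le_pow_iff_left₀ (Real.cosh_pos _).le (Real.cosh_pos _).le two_ne_zero).1 hle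
    rwa [Real.cosh_le_cosh, abs_of_nonneg (kleinDist_nonneg _ _),
      abs_of_nonneg (kleinDist_nonneg _ _)] at h2
  have e : lineDist P Q R = kleinDist R S := hleast.csInf_eq
  rw [e]
  refine ⟨kleinDist_nonneg _ _, ?_⟩
  rw [Real.cosh_sq] at hcosh
  rw [eq_sub_of_add_eq hcosh]
  field_simp
  ring

/-! ### The angle-of-parallelism conditions -/

/-- The angle-of-parallelism relation `sinh Δ · sinh (n d') = 1`, which makes each hypothesis a
comparison of a product of hyperbolic sines with 1. -/
theorem sinh_Delta {n : ℕ} {P Q : ℂ} (h : 0 < n * kleinDist P Q) :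
    Real.sinh (Delta n P Q) = (Real.sinh (n * kleinDist P Q))⁻¹ := by
  have h1 := Real.one_lt_exp_iff.2 h
  rw [Delta, Real.sinh_log (div_pos (by linarith) (by linarith)), Real.sinh_eq, Real.exp_neg]
  generalize Real.exp (n * kleinDist P Q) = y at *
  have h2 : y - 1 ≠ 0 := by linarith
  have h3 : y + 1 ≠ 0 := by linarith
  have h4 : y - y⁻¹ ≠ 0 := by
    have := inv_lt_one_of_one_lt₀ h1
    linarith
  have h5 : y ^ 2 - 1 ≠ 0 := by nlinarith
  field_simp
  ring

theorem Delta_le_iff {n : ℕ} {P Q : ℂ} (h : 0 < n * kleinDist P Q) (y : ℝ) :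
    Delta n P Q ≤ y ↔ 1 ≤ Real.sinh (n * kleinDist P Q) * Real.sinh y := by
  rw [← Real.sinh_le_sinh, sinh_Delta h, inv_le_iff_one_le_mul₀' (Real.sinh_pos_iff.2 h)]

theorem le_Delta_iff {n : ℕ} {P Q : ℂ} (h : 0 < n * kleinDist P Q) (y : ℝ) :
    y ≤ Delta n P Q ↔ Real.sinh (n * kleinDist P Q) * Real.sinh y ≤ 1 := by
  rw [← Real.sinh_le_sinh, sinh_Delta h, ← one_div, le_div_iff₀' (Real.sinh_pos_iff.2 h)]

theorem sinh_two_kleinDist_mul_sinh_lineDist {P Q R : ℂ} (hP : ‖P‖ < 1) (hQ : ‖Q‖ < 1)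
    (hR : ‖R‖ < 1) (hne : P ≠ Q) :
    (Real.sinh ((2 : ℕ) * kleinDist P Q) * Real.sinh (lineDist P Q R)) ^ 2 =
      4 * area P Q R ^ 2 * gram P Q ^ 2 / (gram P P ^ 2 * gram Q Q ^ 2 * gram R R) := by
  have := disc_pos hP hQ hne
  have := gram_self_pos hP
  have := gram_self_pos hQ
  have := gram_self_pos hR
  rw [Nat.cast_two, Real.sinh_two_mul, mul_pow, mul_pow, mul_pow, sinh_sq_kleinDist hP hQ,
    cosh_sq_kleinDist hP hQ, (sinh_sq_lineDist hP hQ hR hne).2]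
  field_simp
  ring

theorem sinh_kleinDist_mul_sinh_two_lineDist {P Q R : ℂ} (hP : ‖P‖ < 1) (hQ : ‖Q‖ < 1)
    (hR : ‖R‖ < 1) (hne : P ≠ Q) :
    (Real.sinh ((1 : ℕ) * kleinDist P Q) * Real.sinh (2 * lineDist P Q R)) ^ 2 =
      4 * area P Q R ^ 2 * (gram R R * disc P Q + area P Q R ^ 2) /
        (gram P P * gram Q Q * gram R R ^ 2 * disc P Q) := by
  have := disc_pos hP hQ hne
  have := gram_self_pos hP
  have := gram_self_pos hQ
  have := gram_self_pos hR
  rw [Nat.cast_one, one_mul, Real.sinh_two_mul, mul_pow, mul_pow, mul_pow,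
    sinh_sq_kleinDist hP hQ, Real.cosh_sq, (sinh_sq_lineDist hP hQ hR hne).2]
  field_simp
  ring

/-! ### The rotation number of a triangle -/

theorem ne_of_area_ne_zero {P Q R : ℂ} (h : area P Q R ≠ 0) : P ≠ Q := by
  rintro rfl
  simp [area, cross] at h

theorem area_rotate (P Q R : ℂ) : area Q R P = area P Q R := by
  simp only [area, cross, sub_re, sub_im]; ring

theorem area_swap (P Q R : ℂ) : area Q P R = -area P Q R := by
  simp only [area, cross, sub_re, sub_im]; ring

theorem disc_comm (P Q : ℂ) : disc P Q = disc Q P := by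
  simp only [disc, gram_comm P Q]; ring

theorem area_ne_zero {P Q R : ℂ} (h : AffineIndependent ℝ ![P, Q, R]) : area P Q R ≠ 0 := by
  intro h0
  have hne : P ≠ Q := fun e => by
    have := h.injective (show ![P, Q, R] 0 = ![P, Q, R] 1 from e)
    simp at this
  rw [affineIndependent_iff_not_collinear_set] at h
  apply h
  have hV : 0 < (Q - P).re ^ 2 + (Q - P).im ^ 2 := by
    rw [← norm_sq_eq_re_im]
    have := norm_pos_iff.2 (sub_ne_zero.2 hne.symm)
    positivity
  have hmem : R ∈ line[ℝ, P, Q] := by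
    rw [mem_affineSpan_pair_iff_exists_lineMap_eq]
    refine ⟨((R - P).re * (Q - P).re + (R - P).im * (Q - P).im) /
      ((Q - P).re ^ 2 + (Q - P).im ^ 2), ?_⟩
    rw [AffineMap.lineMap_apply, vsub_eq_sub, vadd_eq_add, real_smul, ← eq_sub_iff_add_eq]
    rw [area] at h0
    generalize Q - P = V at *
    generalize R - P = U at *
    simp only [cross] at h0
    apply Complex.ext
    · rw [re_ofReal_mul]
      field_simp
      linear_combination V.im * h0
    · rw [im_ofReal_mul]
      field_simp
      linear_combination (-V.re) * h0
  have := collinear_insert_of_mem_affineSpan_pair hmem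
  rwa [Set.insert_comm, Set.pair_comm R Q] at this

theorem fifth_iterate_triangleLift {P Q R : ℂ} (hP : ‖P‖ < 1) (hQ : ‖Q‖ < 1) (hR : ‖R‖ < 1)
    (harea : 0 < area P Q R) :
    ∃ w, (4 * area P Q R ^ 2 * (gram R R * disc P Q + area P Q R ^ 2) ≤
          gram P P * gram Q Q * gram R R ^ 2 * disc P Q → w + 2 ≤ (triangleLift P Q R)^[5] w) ∧
      (gram P P * gram Q Q * gram R R ^ 2 * disc P Q ≤
          4 * area P Q R ^ 2 * (gram R R * disc P Q + area P Q R ^ 2) →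
        (triangleLift P Q R)^[5] w ≤ w + 2) := by
  obtain ⟨a, b, p, q, hf, -⟩ := exists_chordFrame hP hQ (ne_of_area_ne_zero harea.ne')
  obtain ⟨κ, β, γ, hκ, hβ, hγ, hdet, hD, hM⟩ := hf.exists_matrix hR harea
  obtain ⟨w, h1, h2⟩ := hf.fifth_iterate hP hQ hR hκ hβ hγ hM
  have hσ := hf.cross_pos
  have hp := hf.p_pos
  have hq := hp.trans hf.p_lt
  have hq' := sub_pos.2 hf.q_lt
  have hpq := sub_pos.2 hf.p_lt
  have hp' : 0 < 1 - p := by linarith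
  have hn := gram_self_pos hR
  set σ := cross (spin a) (spin b)
  -- The difference factors, and `hfac` shows all factors but the last to be positive; the last
  -- carries the sign of `ChordFrame.fifth_iterate`.
  have key : gram P P * gram Q Q * gram R R ^ 2 * disc P Q -
      4 * area P Q R ^ 2 * (gram R R * disc P Q + area P Q R ^ 2) =
      64 * σ ^ 8 * (q - p) ^ 2 * (β * γ * (q * (1 - p)) - κ ^ 2 * (p * (1 - q))) *
        (β * γ * (p * (1 - q)) - κ ^ 2 * (q * (1 - p))) := by
    rw [hf.gram_left_eq, hf.gram_right_eq, hf.disc_eq, hD, hdet]; ring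
  have hfac : 0 < 64 * σ ^ 8 * (q - p) ^ 2 *
      (β * γ * (q * (1 - p)) - κ ^ 2 * (p * (1 - q))) := by
    have : β * γ * (q * (1 - p)) - κ ^ 2 * (p * (1 - q)) =
        gram R R * (q * (1 - p)) + κ ^ 2 * (q - p) := by rw [hdet]; ring
    rw [this]; positivity
  refine ⟨w, fun h => h1 ?_, fun h => h2 ?_⟩
  · rw [← sub_nonneg, key] at h
    exact sub_nonneg.1 (nonneg_of_mul_nonneg_right h hfac)
  · rw [← sub_nonpos, key] at h
    exact sub_nonpos.1 (nonpos_of_mul_nonpos_right h hfac)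

theorem exists_fifth_iterate_le {P Q R : ℂ} (hP : ‖P‖ < 1) (hQ : ‖Q‖ < 1) (hR : ‖R‖ < 1)
    (harea : 0 < area P Q R)
    (h : gram P P ^ 2 * gram Q Q ^ 2 * gram R R ≤ 4 * area P Q R ^ 2 * gram P Q ^ 2) :
    ∃ v, (triangleLift P Q R)^[5] v ≤ v + 2 := by
  obtain ⟨a, b, p, q, hf, -⟩ := exists_chordFrame hP hQ (ne_of_area_ne_zero harea.ne')
  obtain ⟨κ, β, γ, hκ, hβ, hγ, hdet, hD, hM⟩ := hf.exists_matrix hR harea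
  refine hf.exists_iterate_le hP hQ hR hκ hβ hγ hM ?_
  have hσ := hf.cross_pos
  set σ := cross (spin a) (spin b)
  have key : 4 * area P Q R ^ 2 * gram P Q ^ 2 - gram P P ^ 2 * gram Q Q ^ 2 * gram R R =
      64 * σ ^ 8 * (κ ^ 2 * ((p * (1 - q)) ^ 2 + (q * (1 - p)) ^ 2) ^ 2 -
        4 * (p * (1 - q)) ^ 2 * (q * (1 - p)) ^ 2 * (β * γ)) := by
    rw [hf.gram_eq, hf.gram_left_eq, hf.gram_right_eq, hD, hdet]; ring
  rw [← sub_nonneg, key] at h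
  exact sub_nonneg.1 (nonneg_of_mul_nonneg_right h (by positivity))

/-- The distance from `P` to the line `QR` is at most the distance from `P` to `Q`. -/
theorem gram_mul_le_gram_sq_mul_disc (P Q R : ℂ) :
    gram Q Q * (gram P P * disc Q R + area P Q R ^ 2) ≤ gram P Q ^ 2 * disc Q R := by
  have h := gram_sq_mul_disc_sub Q R P 0 (S := Q) rfl (by simp)
  rw [area_rotate] at h
  exact sub_nonneg.1 ((sq_nonneg _).trans_eq h.symm)

/-- The exact comparison for the side `QR` with opposite vertex `P` has a sufficient condition in
terms of `gram P Q`, by `gram_mul_le_gram_sq_mul_disc`; relabelling vertices cyclically changes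
neither `F` nor the area. -/
theorem exists_le_fifth_iterate {P Q R : ℂ} (hP : ‖P‖ < 1) (hQ : ‖Q‖ < 1) (hR : ‖R‖ < 1)
    (harea : 0 < area P Q R)
    (h : 4 * area P Q R ^ 2 * gram P Q ^ 2 ≤ gram P P ^ 2 * gram Q Q ^ 2 * gram R R) :
    ∃ w, w + 2 ≤ (triangleLift P Q R)^[5] w := by
  rw [← area_rotate] at harea
  obtain ⟨w, hw, -⟩ := fifth_iterate_triangleLift hQ hR hP harea
  rw [triangleLift_rotate, area_rotate] at hw
  refine ⟨w, hw ?_⟩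
  have hE := disc_pos hQ hR (ne_of_area_ne_zero harea.ne')
  have hnQ := gram_self_pos hQ
  have h1 := mul_le_mul_of_nonneg_left (gram_mul_le_gram_sq_mul_disc P Q R)
    (show 0 ≤ 4 * area P Q R ^ 2 by positivity)
  have h2 := mul_le_mul_of_nonneg_right h hE.le
  refine le_of_mul_le_mul_left ?_ hnQ
  linarith

theorem hasRotationNumber_of_area_pos {P Q R : ℂ} (hP : ‖P‖ < 1) (hQ : ‖Q‖ < 1) (hR : ‖R‖ < 1)
    (harea : 0 < area P Q R)
    (h : (gram P P ^ 2 * gram Q Q ^ 2 * gram R R ≤ 4 * area P Q R ^ 2 * gram P Q ^ 2 ∧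
          4 * area P Q R ^ 2 * (gram R R * disc P Q + area P Q R ^ 2) ≤
            gram P P * gram Q Q * gram R R ^ 2 * disc P Q) ∨
        (gram P P * gram Q Q * gram R R ^ 2 * disc P Q ≤
            4 * area P Q R ^ 2 * (gram R R * disc P Q + area P Q R ^ 2) ∧
          4 * area P Q R ^ 2 * gram P Q ^ 2 ≤ gram P P ^ 2 * gram Q Q ^ 2 * gram R R)) :
    HasRotationNumber (psi (convexHull ℝ ({P, Q, R} : Set ℂ))) (2 / 5) := by
  have hl := isNormalizedLift_triangleLift hP hQ hR
  refine ⟨triangleLift P Q R, hl, ?_⟩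
  obtain ⟨w, hw, hw'⟩ := fifth_iterate_triangleLift hP hQ hR harea
  have hlo : ∃ x, x + 2 ≤ (triangleLift P Q R)^[5] x := by
    rcases h with h | h
    · exact ⟨w, hw h.2⟩
    · exact exists_le_fifth_iterate hP hQ hR harea h.2
  have hhi : ∃ x, (triangleLift P Q R)^[5] x ≤ x + 2 := by
    rcases h with h | h
    · exact exists_fifth_iterate_le hP hQ hR harea h.1
    · exact ⟨w, hw' h.1⟩
  exact_mod_cast tendsto_rotation_of_crossing (n := 5) (k := 2) hl.continuous
    hl.strictMono.monotone hl.map_add_one (by norm_num) (by exact_mod_cast hlo)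
    (by exact_mod_cast hhi)

end BarBilliard

end

open BarBilliard in
theorem theorem4p9 (P Q R : ℂ) (hP : ‖P‖ < 1) (hQ : ‖Q‖ < 1) (hR : ‖R‖ < 1)
    (hPQR : AffineIndependent ℝ ![P, Q, R])
    (h : (BarBilliard.Delta 2 P Q ≤ BarBilliard.lineDist P Q R ∧
            BarBilliard.lineDist P Q R ≤ 1 / 2 * BarBilliard.Delta 1 P Q) ∨
         (1 / 2 * BarBilliard.Delta 1 P Q ≤ BarBilliard.lineDist P Q R ∧
            BarBilliard.lineDist P Q R ≤ BarBilliard.Delta 2 P Q)) :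
    BarBilliard.HasRotationNumber
      (BarBilliard.psi (convexHull ℝ ({P, Q, R} : Set ℂ))) (2 / 5) := by
  have harea := area_ne_zero hPQR
  have hne := ne_of_area_ne_zero harea
  have hd := kleinDist_pos hP hQ hne
  have hd1 : 0 < (1 : ℕ) * kleinDist P Q := by simpa using hd
  have hd2 : 0 < (2 : ℕ) * kleinDist P Q := by simpa using hd
  have hδ := (sinh_sq_lineDist hP hQ hR hne).1
  have hE := disc_pos hP hQ hne
  have hnP := gram_self_pos hP
  have hnQ := gram_self_pos hQ
  have hnR := gram_self_pos hR
  have e2 := sinh_two_kleinDist_mul_sinh_lineDist hP hQ hR hne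
  have e1 := sinh_kleinDist_mul_sinh_two_lineDist hP hQ hR hne
  have hpos2 : 0 ≤ Real.sinh ((2 : ℕ) * kleinDist P Q) * Real.sinh (lineDist P Q R) :=
    mul_nonneg (Real.sinh_nonneg_iff.2 hd2.le) (Real.sinh_nonneg_iff.2 hδ)
  have hpos1 : 0 ≤ Real.sinh ((1 : ℕ) * kleinDist P Q) * Real.sinh (2 * lineDist P Q R) :=
    mul_nonneg (Real.sinh_nonneg_iff.2 hd1.le) (Real.sinh_nonneg_iff.2 (by linarith))
  have half_le : 1 / 2 * Delta 1 P Q ≤ lineDist P Q R ↔ Delta 1 P Q ≤ 2 * lineDist P Q R := by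
    constructor <;> intro _ <;> linarith
  have le_half : lineDist P Q R ≤ 1 / 2 * Delta 1 P Q ↔ 2 * lineDist P Q R ≤ Delta 1 P Q := by
    constructor <;> intro _ <;> linarith
  -- Both products of hyperbolic sines are nonnegative, so they may be compared with 1 after
  -- squaring, where they are rational in `gram`, `disc` and `area`.
  rw [half_le, le_half, Delta_le_iff hd2, Delta_le_iff hd1, le_Delta_iff hd2, le_Delta_iff hd1,
    ← one_le_sq_iff₀ hpos2, ← one_le_sq_iff₀ hpos1, ← sq_le_one_iff₀ hpos2,
    ← sq_le_one_iff₀ hpos1, e1, e2, one_le_div (by positivity), one_le_div (by positivity),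
    div_le_one (by positivity), div_le_one (by positivity)] at h
  -- The polynomial conditions are symmetric in `P` and `Q`, so a negatively oriented triangle is
  -- handled by exchanging them.
  rcases harea.lt_or_gt with hneg | hpos
  · have hswap : ({P, Q, R} : Set ℂ) = {Q, P, R} := Set.insert_comm P Q {R}
    rw [hswap]
    refine hasRotationNumber_of_area_pos hQ hP hR (by rw [area_swap]; linarith) ?_
    rw [area_swap, neg_sq, gram_comm Q P, disc_comm Q P, mul_comm (gram Q Q) (gram P P),
      mul_comm (gram Q Q ^ 2) (gram P P ^ 2)]
    exact h
  · exact hasRotationNumber_of_area_pos hP hQ hR hpos h
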